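/- Let $\mathbb N=\{1,2,\dots\}$, let $n,k,m_1,m_2,m_3\in\mathbb N$, let $M_k$ be the algebra of complex $k\times k$ matrices with the operator norm, let $p,q\in M_k$ be orthogonal projections, and let $v=(v_1,\dots,v_n)\in M_k^n$. Notation. For $l\in\mathbb N$ and $\mu=(\mu_0,\dots,\mu_{l-1})\in\{1,\dots,n\}^l$ put $\widehat v_\mu=v_{\mu_0}v_{\mu_1}\cdots v_{\mu_{l-1}}$ and $\widehat\psi_\mu=\psi_{\mu_0}\otimes\cdots\otimes\psi_{\mu_{l-1}}$, where $(\psi_\mu)_{\mu=1}^n$ is a fixed orthonormal basis of $\mathbb C^n$. Let $\mathcal K_l(v)=\operatorname{span}\{\widehat v_\mu:\mu\in\{1,\dots,n\}^l\}$, let $T_v(X)=\sum_{\mu=1}^n v_\mu Xv_\mu^*$ for $X\in M_k$, and let $$\Gamma_{l,v}:M_k\to(\mathbb C^n)^{\otimes l},\qquad \Gamma_{l,v}(X)=\sum_{\mu\in\{1,\dots,n\}^l}\operatorname{Tr}(X\widehat v_\mu^{\,*})\,\widehat\psi_\mu,\qquad \mathcal G_{l,v}=\operatorname{Ran}\Gamma_{l,v}.$$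 For a projection $r$ write $\bar r=1-r$ and $v_r=(rv_1r,\dots,rv_nr)$; $s(\cdot)$ denotes the support projection of a positive element or of a positive linear functional. Let $M_{v,p,q}\in\mathbb N\cup\{\infty\}$ be the infimum of all $M\in\mathbb N$ such that $\Gamma_{N,v}$ is injective on $pM_kq$ for all $N\ge M$ (with $\inf\emptyset=\infty$). Condition 1. A sequence of nonzero subspaces $\mathcal D_l\subset(\mathbb C^n)^{\otimes l}$ $(l\in\mathbb N)$, with orthogonal projections $G_l$ onto $\mathcal D_l$, satisfies Condition 1 for $(m_0,l_0)\in\mathbb N^2$ if * (i) for all $N\ge m_0$: $\mathcal D_N=\bigcap_{x=0}^{N-m_0}(\mathbb C^n)^{\otimes x}\otimes\mathcal D_{m_0}\otimes(\mathbb C^n)^{\otimes(N-m_0-x)}$; * (ii) for every $l\ge l_0$ there is $0<\varepsilon_l<1/\sqrt l$ such that for all $N\ge 2l$, on $(\mathbb C^n)^{\otimes(N+1)}$ (sites $0,\dots,N$), $\big\|(1_{[0,N-l]}\otimes G_l)(G_N\otimes 1_{\{N\}}-G_{N+1})\big\|<\varepsilon_l$. Assume: * Condition 2: * (i) $pq=qp\ne0$;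 * (ii) $v_\mu p=pv_\mu p$ for all $\mu$; * (iii) $qv_\mu=qv_\mu q$ for all $\mu$; * (iv) there are $c>0$, $0<s<1$, a positive linear functional $\varphi$ on $M_k$ and a positive $e\in M_k$ with $s(\varphi)=s(e)=pq$ and $\|T_{v_{pq}}^N(A)-\varphi(A)e\|\le cs^N\|A\|$ for all $A\in M_k$, $N\in\mathbb N$; * (v) there are $c>0$, $0<s<1$ with $\|T_{v_{\bar q}}^N(A)\|\le cs^N\|A\|$ for all $A\in M_k$, $N\in\mathbb N$; * (vi) there are $c>0$, $0<s<1$ with $\|T_{v_{\bar p}}^N(A)\|\le cs^N\|A\|$ for all $A\in M_k$, $N\in\mathbb N$; * (vii) for every $\eta\in q\mathbb C^k$ with $pq\eta\ne0$ there is $l\in\mathbb N$ with $\mathcal K_l(v_q)^*\eta=q\mathbb C^k$; * (viii) for every $\xi\in p\mathbb C^k$ with $pq\xi\ne0$ there is $l\in\mathbb N$ with $\mathcal K_l(v_p)\xi=p\mathbb C^k$. * Condition 3: $\dim\mathcal K_N(v)=(\operatorname{rank}p)(\operatorname{rank}q)$ for all $N\ge m_1$. * Condition 4: there is an invertible $X\in\mathcal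 K_{m_2}(v)$ with $X^{-1}\mathcal K_{N+m_2}(v)\subset\mathcal K_N(v)$ for all $N\ge m_3$. Then $M_{v,p,q}<\infty$, and there is $l_0\in\mathbb N$ such that $\{\mathcal G_{l,v}\}_{l\in\mathbb N}$ (in particular, each $\mathcal G_{l,v}$ is nonzero) satisfies Condition 1 for $(m_2+m_3,\,l_0)$. -/

import Mathlib

namespace MPS

open scoped Matrix Kronecker ComplexOrder Matrix.Norms.L2Operator

noncomputable section

/-! ### The spin chain -/

/-- The Hilbert space `⨂_{i=0}^{l-1} ℂⁿ`, in coordinates with respect to the product orthonormal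
basis `ψ_{μ₀} ⊗ ⋯ ⊗ ψ_{μ_{l-1}}`, which is indexed by the words `μ : Fin l → Fin n`. -/
abbrev ChainSpace (n l : ℕ) : Type := EuclideanSpace ℂ (Fin l → Fin n)

/-- The subword of length `m` starting at site `x` of a word of length `N`. -/
def subword {n : ℕ} (x m N : ℕ) (h : x + m ≤ N) (s : Fin N → Fin n) : Fin m → Fin n :=
  fun i => s ⟨x + i, by have := i.isLt; omega⟩

/-- Cut a word of length `N` into its first `x` letters, the next `m` letters, and the last
`N - m - x` letters. -/
def cut {n : ℕ} (x m N : ℕ) (h : x + m ≤ N) (s : Fin N → Fin n) :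
    ((Fin x → Fin n) × (Fin m → Fin n)) × (Fin (N - m - x) → Fin n) :=
  ((subword 0 x N (by omega) s, subword x m N h s),
    subword (x + m) (N - m - x) N (by omega) s)

/-- The product vector `a ⊗ w ⊗ b`, for `a` on the sites `[0, x-1]`, `w` on `[x, x+m-1]` and
`b` on `[x+m, N-1]`. -/
def productVector {n : ℕ} (x m N : ℕ) (h : x + m ≤ N) (a : ChainSpace n x) (w : ChainSpace n m)
    (b : ChainSpace n (N - m - x)) : ChainSpace n N :=
  WithLp.toLp 2 fun s =>
    a (cut x m N h s).1.1 * w (cut x m N h s).1.2 * b (cut x m N h s).2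

/-- The subspace `(ℂⁿ)^{⊗ x} ⊗ D ⊗ (ℂⁿ)^{⊗ (N-m-x)}` of `(ℂⁿ)^{⊗ N}`, for a subspace `D` of
`(ℂⁿ)^{⊗ m}`. -/
def ampliateSubspace {n : ℕ} (x m N : ℕ) (h : x + m ≤ N) (D : Submodule ℂ (ChainSpace n m)) :
    Submodule ℂ (ChainSpace n N) :=
  Submodule.span ℂ {f | ∃ a b, ∃ w ∈ D, f = productVector x m N h a w b}

/-- The operator `1 ⊗ A ⊗ 1` on `(ℂⁿ)^{⊗ N}`, for an operator `A` acting on the sites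
`[x, x+m-1]`. Its matrix is the Kronecker product of the identity, the matrix of `A` and the
identity. -/
def ampliate {n : ℕ} (x m N : ℕ) (h : x + m ≤ N) (A : ChainSpace n m →L[ℂ] ChainSpace n m) :
    ChainSpace n N →L[ℂ] ChainSpace n N :=
  Matrix.toEuclideanCLM (𝕜 := ℂ) (n := Fin N → Fin n)
    ((((1 : Matrix (Fin x → Fin n) (Fin x → Fin n) ℂ) ⊗ₖ
        (Matrix.toEuclideanCLM (𝕜 := ℂ) (n := Fin m → Fin n)).symm A) ⊗ₖ
        (1 : Matrix (Fin (N - m - x) → Fin n) (Fin (N - m - x) → Fin n) ℂ)).submatrix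
      (cut x m N h) (cut x m N h))

/-- The orthogonal projection onto a subspace of the chain space. -/
def projection {n l : ℕ} (D : Submodule ℂ (ChainSpace n l)) :
    ChainSpace n l →L[ℂ] ChainSpace n l :=
  haveI : D.HasOrthogonalProjection := Submodule.HasOrthogonalProjection.ofCompleteSpace D
  D.starProjection

/-- The intersection property with parameter `m`:
`D_N = ⋂_{x=0}^{N-m} (ℂⁿ)^{⊗ x} ⊗ D_m ⊗ (ℂⁿ)^{⊗ (N-m-x)}` for all `N ≥ m`. -/
def IntersectionProperty {n : ℕ} (D : ∀ l : ℕ, Submodule ℂ (ChainSpace n l)) (m : ℕ) : Prop :=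
  ∀ N : ℕ, m ≤ N → D N = ⨅ (x : ℕ) (h : x + m ≤ N), ampliateSubspace x m N h (D m)

/-- The condition on a sequence of nonzero subspaces `D_l ⊆ (ℂⁿ)^{⊗ l}`, `l ≥ 1`, which yields a
spectral gap, with its parameters `m₀, l₀`. The space `D 0` plays no role. -/
structure GapCondition {n : ℕ} (D : ∀ l : ℕ, Submodule ℂ (ChainSpace n l)) (m₀ l₀ : ℕ) :
    Prop where
  ne_bot : ∀ l, 1 ≤ l → D l ≠ ⊥
  one_le_m : 1 ≤ m₀
  one_le_l : 1 ≤ l₀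
  intersection : IntersectionProperty D m₀
  overlap : ∀ l, l₀ ≤ l → ∃ ε : ℝ, 0 < ε ∧ ε < 1 / √(l : ℝ) ∧
    ∀ (N : ℕ) (hN : 2 * l ≤ N),
      ‖ampliate (N - l + 1) l (N + 1) (by omega) (projection (D l)) ∘L
          (ampliate 0 N (N + 1) (by omega) (projection (D N)) -
            projection (D (N + 1)))‖ < ε

/-! ### Matrix product vectors -/

/-- The monomial `v_{μ₀} v_{μ₁} ⋯ v_{μ_{l-1}}`. -/
def monomial {n k l : ℕ} (v : Fin n → Matrix (Fin k) (Fin k) ℂ) (μ : Fin l → Fin n) :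
    Matrix (Fin k) (Fin k) ℂ :=
  (List.ofFn fun i => v (μ i)).prod

/-- `𝒦_l(v)`, the span of the monomials of degree `l`. -/
def monomialSpan {n k : ℕ} (v : Fin n → Matrix (Fin k) (Fin k) ℂ) (l : ℕ) :
    Submodule ℂ (Matrix (Fin k) (Fin k) ℂ) :=
  Submodule.span ℂ (Set.range fun μ : Fin l → Fin n => monomial v μ)

/-- `Γ_{l,v}(X) = ∑_μ Tr(X (v_{μ₀} ⋯ v_{μ_{l-1}})^*) ψ_{μ₀} ⊗ ⋯ ⊗ ψ_{μ_{l-1}}`. -/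
def gammaMap {n k : ℕ} (v : Fin n → Matrix (Fin k) (Fin k) ℂ) (l : ℕ) :
    Matrix (Fin k) (Fin k) ℂ →ₗ[ℂ] ChainSpace n l where
  toFun X := WithLp.toLp 2 fun μ => (X * (monomial v μ)ᴴ).trace
  map_add' X Y := by ext μ; simp [Matrix.add_mul]
  map_smul' c X := by ext μ; simp

/-- `𝒢_{l,v}`, the range of `Γ_{l,v}`. -/
def groundSpace {n k : ℕ} (v : Fin n → Matrix (Fin k) (Fin k) ℂ) (l : ℕ) :
    Submodule ℂ (ChainSpace n l) :=
  LinearMap.range (gammaMap v l)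

/-- `M_{v,p,q}`, the infimum in `ℕ ∪ {∞}` of the `M ≥ 1` such that `Γ_{N,v}` is injective on
`p M_k q` for all `N ≥ M`. -/
def injectivityIndex {n k : ℕ} (v : Fin n → Matrix (Fin k) (Fin k) ℂ)
    (p q : Matrix (Fin k) (Fin k) ℂ) : ℕ∞ :=
  sInf ((fun M : ℕ => (M : ℕ∞)) ''
    {M : ℕ | 1 ≤ M ∧ ∀ N, M ≤ N →
      Set.InjOn (gammaMap v N) (Set.range fun X : Matrix (Fin k) (Fin k) ℂ => p * X * q)})

/-- The completely positive map `T_v(X) = ∑_μ v_μ X v_μ^*`. -/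
def transferMap {n k : ℕ} (v : Fin n → Matrix (Fin k) (Fin k) ℂ) :
    Module.End ℂ (Matrix (Fin k) (Fin k) ℂ) where
  toFun X := ∑ μ, v μ * X * (v μ)ᴴ
  map_add' X Y := by simp [Matrix.mul_add, Matrix.add_mul, Finset.sum_add_distrib]
  map_smul' c X := by simp [Finset.smul_sum]

/-- The compressed tuple `v_p = (p v₁ p, …, p vₙ p)`. -/
def compress {n k : ℕ} (v : Fin n → Matrix (Fin k) (Fin k) ℂ) (p : Matrix (Fin k) (Fin k) ℂ) :
    Fin n → Matrix (Fin k) (Fin k) ℂ :=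
  fun μ => p * v μ * p

/-- Positivity of a linear functional on `M_k`. -/
def IsPositiveFunctional {k : ℕ} (φ : Matrix (Fin k) (Fin k) ℂ →ₗ[ℂ] ℂ) : Prop :=
  ∀ A : Matrix (Fin k) (Fin k) ℂ, A.PosSemidef → 0 ≤ φ A

/-- `r` is the support `s(φ)` of the positive functional `φ`: the smallest orthogonal projection
with `φ(1 - r) = 0`. -/
def IsFunctionalSupport {k : ℕ} (φ : Matrix (Fin k) (Fin k) ℂ →ₗ[ℂ] ℂ)
    (r : Matrix (Fin k) (Fin k) ℂ) : Prop :=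
  IsStarProjection r ∧ φ (1 - r) = 0 ∧
    ∀ r' : Matrix (Fin k) (Fin k) ℂ, IsStarProjection r' → φ (1 - r') = 0 → r' * r = r

/-- `r` is the support `s(e)` of the positive element `e`: the smallest orthogonal projection
with `r e = e`. -/
def IsElementSupport {k : ℕ} (e r : Matrix (Fin k) (Fin k) ℂ) : Prop :=
  IsStarProjection r ∧ r * e = e ∧
    ∀ r' : Matrix (Fin k) (Fin k) ℂ, IsStarProjection r' → r' * e = e → r' * r = r

/-- The powers of `T_v` decay exponentially: `‖T_v^N(A)‖ ≤ c s^N ‖A‖` for all `A` and `N ≥ 1`,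
with some `c > 0` and `0 < s < 1`. Norms of matrices are operator norms. -/
def TransferDecays {n k : ℕ} (v : Fin n → Matrix (Fin k) (Fin k) ℂ) : Prop :=
  ∃ c s : ℝ, 0 < c ∧ 0 < s ∧ s < 1 ∧
    ∀ (A : Matrix (Fin k) (Fin k) ℂ) (N : ℕ), 1 ≤ N →
      ‖(transferMap v ^ N) A‖ ≤ c * s ^ N * ‖A‖

/-- Invariance of `p` and `q`, spectral convergence of the compressed transfer maps, and
cyclicity. -/
structure TransferCondition {n k : ℕ} (p q : Matrix (Fin k) (Fin k) ℂ)
    (v : Fin n → Matrix (Fin k) (Fin k) ℂ) : Prop where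
  commute : p * q = q * p
  mul_ne_zero : p * q ≠ 0
  invariant_p : ∀ μ, v μ * p = p * v μ * p
  invariant_q : ∀ μ, q * v μ = q * v μ * q
  spectral_pq : ∃ (c s : ℝ) (φ : Matrix (Fin k) (Fin k) ℂ →ₗ[ℂ] ℂ)
    (e : Matrix (Fin k) (Fin k) ℂ), 0 < c ∧ 0 < s ∧ s < 1 ∧
      IsPositiveFunctional φ ∧ e.PosSemidef ∧
      IsFunctionalSupport φ (p * q) ∧ IsElementSupport e (p * q) ∧
      ∀ (A : Matrix (Fin k) (Fin k) ℂ) (N : ℕ), 1 ≤ N →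
        ‖(transferMap (compress v (p * q)) ^ N) A - φ A • e‖ ≤ c * s ^ N * ‖A‖
  decay_q : TransferDecays (compress v (1 - q))
  decay_p : TransferDecays (compress v (1 - p))
  cyclic_q : ∀ η ∈ Set.range (q *ᵥ ·), (p * q) *ᵥ η ≠ 0 → ∃ l, 1 ≤ l ∧
    (fun X : Matrix (Fin k) (Fin k) ℂ => Xᴴ *ᵥ η) '' (monomialSpan (compress v q) l : Set _) =
      Set.range (q *ᵥ ·)
  cyclic_p : ∀ ξ ∈ Set.range (p *ᵥ ·), (p * q) *ᵥ ξ ≠ 0 → ∃ l, 1 ≤ l ∧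
    (fun X : Matrix (Fin k) (Fin k) ℂ => X *ᵥ ξ) '' (monomialSpan (compress v p) l : Set _) =
      Set.range (p *ᵥ ·)

/-- `dim 𝒦_N(v) = rank p · rank q` for all `N ≥ m₁`. -/
def RankCondition {n k : ℕ} (p q : Matrix (Fin k) (Fin k) ℂ)
    (v : Fin n → Matrix (Fin k) (Fin k) ℂ) (m₁ : ℕ) : Prop :=
  ∀ N, m₁ ≤ N → Module.finrank ℂ (monomialSpan v N) = p.rank * q.rank

/-- There is an invertible `X ∈ 𝒦_{m₂}(v)` with `X⁻¹ 𝒦_{N+m₂}(v) ⊆ 𝒦_N(v)` for all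
`N ≥ m₃`. -/
def ShiftCondition {n k : ℕ} (v : Fin n → Matrix (Fin k) (Fin k) ℂ) (m₂ m₃ : ℕ) : Prop :=
  ∃ X ∈ monomialSpan v m₂, IsUnit X ∧
    ∀ N, m₃ ≤ N → ∀ Y ∈ monomialSpan v (N + m₂), X⁻¹ * Y ∈ monomialSpan v N

end

end MPS

/-!
# Spectral gap condition for matrix product vectors with two invariant projections

The transfer map `T = T_v` governs everything through
`⟨Γ_N X, Γ_N Y⟩ = ∑ᵢⱼ (X^* T^N(Eᵢⱼ) Y)ᵢⱼ`.

**Intersection property.** Let `f` restrict to matrix product vectors on the first and on the last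
`N` of `N + 1` sites, say `f(u b) = Tr(Y_b v_u^*)`, and `f(a w) = Tr(U_a v_w^*)` for words `a` of
length `m₂`. Averaging over `a` with the coefficients of the invertible `X = ∑ c_a v_a` gives
`Tr(X^* Y_b σ^*) = Tr((∑ c̄_a U_a) v_b^* σ^*)` for `σ ∈ 𝒦_{N-m₂}`. By the shift condition every
`v_u` is `X σ` with such a `σ`, so `f` is the vector of `(X^*)⁻¹ ∑ c̄_a U_a`
(`mem_groundSpace_succ`).

**Asymptotics of `T^N`.** The flag `p(1-q) ≤ p ≤ 1` makes all `v_μ` block triangular, with diagonal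
blocks `v_{1-p}`, `v_{pq}`, `v_{p(1-q)}`. By Cauchy–Schwarz the block maps `X ↦ ∑ a_μ X b_μ^*`
decay, except for the one with `a = b = v_{pq}`. Hence the only eigenvalue of `T` of modulus at
least one is `1`; it is simple, because an eigenvector is determined by its `(pq, pq)` block
(`TransferCondition.eq_zero_of_eigen`), and Gelfand's formula gives `T^N(X) = Tr(ρ X) e + O(s^N)`
(`TransferCondition.exists_rank_one_limit`). Both `e` and `ρ` may be taken positive; their kernels
are invariant under the `v_μ^*` and the `v_μ` respectively, and cyclicity forces them to be those
of `p` and `q` (`TransferCondition.exists_asymptotics`).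

**Consequences.** The Gram form of `Γ_N` is `Tr(ρ X^* e Y) + O(s^N)`, so `Γ_N` is bounded below on
`p M_k q` for large `N` (`TransferCondition.exists_le_norm_gammaMap`), and by the rank condition
it maps `p M_k q` onto the ground space (`TransferCondition.exists_lift`). For the overlap
estimate take `f` in the ground space of the first `N` sites, orthogonal to that of all `N + 1`,
and `g` in the ground space of the last `l` sites. Up to `O(s^l)`, `⟨g, f⟩` equals `Tr(Z U)` with
`Z` built from `f` and `U` from `g`, and the orthogonality of `f` says that `e Z`, hence
`Z`, is exponentially small (`norm_inner_le_of_gram`).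
-/

namespace MPS

open scoped Matrix Kronecker ComplexOrder Matrix.Norms.L2Operator
open Filter Topology

/-! ### Norms of matrices -/

section MatrixNorm

variable {k : ℕ}

theorem norm_entry_le (A : Matrix (Fin k) (Fin k) ℂ) (i j : Fin k) : ‖A i j‖ ≤ ‖A‖ := by
  have h := Matrix.l2_opNorm_mulVec A (EuclideanSpace.single j (1 : ℂ))
  have h2 := PiLp.norm_apply_le ((EuclideanSpace.equiv (Fin k) ℂ).symm
    (A *ᵥ (EuclideanSpace.single j (1 : ℂ)).ofLp)) i
  simp at h h2
  exact h2.trans h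

theorem norm_trace_le (A : Matrix (Fin k) (Fin k) ℂ) : ‖A.trace‖ ≤ k * ‖A‖ := by
  calc ‖A.trace‖ ≤ ∑ i, ‖A i i‖ := norm_sum_le _ _
    _ ≤ ∑ _i : Fin k, ‖A‖ := Finset.sum_le_sum fun i _ => norm_entry_le A i i
    _ = k * ‖A‖ := by simp

theorem trace_mul_conjTranspose_self (A : Matrix (Fin k) (Fin k) ℂ) :
    (A * Aᴴ).trace = ((∑ i, ∑ j, ‖A i j‖ ^ 2 : ℝ) : ℂ) := by
  simp [Matrix.trace, Matrix.mul_apply, Complex.mul_conj, Complex.normSq_eq_norm_sq]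

/-- The operator norm is dominated by the Hilbert–Schmidt norm. -/
theorem norm_sq_le_re_trace (A : Matrix (Fin k) (Fin k) ℂ) : ‖A‖ ^ 2 ≤ (A * Aᴴ).trace.re := by
  rw [trace_mul_conjTranspose_self, Complex.ofReal_re]
  have hS : 0 ≤ ∑ i, ∑ j, ‖A i j‖ ^ 2 := by positivity
  have : ‖A‖ ≤ √(∑ i, ∑ j, ‖A i j‖ ^ 2) := by
    rw [Matrix.cstar_norm_def]
    refine ContinuousLinearMap.opNorm_le_bound _ (Real.sqrt_nonneg _) fun x => ?_
    rw [EuclideanSpace.norm_eq, EuclideanSpace.norm_eq, ← Real.sqrt_mul hS]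
    refine Real.sqrt_le_sqrt ?_
    rw [Finset.sum_mul]
    refine Finset.sum_le_sum fun i _ => ?_
    rw [Matrix.ofLp_toEuclideanCLM]
    calc ‖(A *ᵥ x.ofLp) i‖ ^ 2 ≤ (∑ j, ‖A i j‖ * ‖x j‖) ^ 2 := by
          gcongr
          simpa only [Matrix.mulVec, dotProduct, norm_mul] using
            norm_sum_le Finset.univ fun j => A i j * x.ofLp j
      _ ≤ _ := Finset.sum_mul_sq_le_sq_mul_sq _ _ _
  calc ‖A‖ ^ 2 ≤ √(∑ i, ∑ j, ‖A i j‖ ^ 2) ^ 2 := by gcongr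
    _ = _ := Real.sq_sqrt hS

end MatrixNorm

/-! ### Words, monomials and the maps `X ↦ ∑ a_μ X b_μ^*` -/

section Words

variable {n k : ℕ}

@[simp]
theorem monomial_zero (v : Fin n → Matrix (Fin k) (Fin k) ℂ) (u : Fin 0 → Fin n) :
    monomial v u = 1 := by
  simp [monomial]

theorem monomial_cons {l : ℕ} (v : Fin n → Matrix (Fin k) (Fin k) ℂ) (i : Fin n)
    (u : Fin l → Fin n) :
    monomial v (Fin.cons i u : Fin (l + 1) → Fin n) = v i * monomial v u := by
  simp [monomial, List.ofFn_succ]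

theorem monomial_append {l m : ℕ} (v : Fin n → Matrix (Fin k) (Fin k) ℂ)
    (a : Fin l → Fin n) (w : Fin m → Fin n) :
    monomial v (Fin.append a w) = monomial v a * monomial v w := by
  have : (fun i => v (Fin.append a w i)) = Fin.append (fun i => v (a i)) fun i => v (w i) := by
    ext1 i
    refine Fin.addCases (fun i => ?_) (fun i => ?_) i <;> simp
  rw [monomial, this, List.ofFn_fin_append, List.prod_append, monomial, monomial]

theorem monomial_snoc {l : ℕ} (v : Fin n → Matrix (Fin k) (Fin k) ℂ)
    (u : Fin l → Fin n) (i : Fin n) :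
    monomial v (Fin.snoc u i : Fin (l + 1) → Fin n) = monomial v u * v i := by
  rw [monomial, List.ofFn_succ']
  simp [monomial, List.concat_eq_append]

theorem monomial_mem_monomialSpan {l : ℕ} (v : Fin n → Matrix (Fin k) (Fin k) ℂ)
    (u : Fin l → Fin n) : monomial v u ∈ monomialSpan v l :=
  Submodule.subset_span ⟨u, rfl⟩

/-- The map `X ↦ ∑_μ a_μ X b_μ^*`. It is the block of a transfer map between two compressions of
the same tuple. -/
def mixedMap (a b : Fin n → Matrix (Fin k) (Fin k) ℂ) :
    Module.End ℂ (Matrix (Fin k) (Fin k) ℂ) where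
  toFun X := ∑ μ, a μ * X * (b μ)ᴴ
  map_add' X Y := by simp [Matrix.mul_add, Matrix.add_mul, Finset.sum_add_distrib]
  map_smul' c X := by simp [Finset.smul_sum]

theorem mixedMap_apply (a b : Fin n → Matrix (Fin k) (Fin k) ℂ) (X : Matrix (Fin k) (Fin k) ℂ) :
    mixedMap a b X = ∑ μ, a μ * X * (b μ)ᴴ := rfl

theorem transferMap_apply (v : Fin n → Matrix (Fin k) (Fin k) ℂ) (X : Matrix (Fin k) (Fin k) ℂ) :
    transferMap v X = ∑ μ, v μ * X * (v μ)ᴴ := rfl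

theorem sum_cons {l : ℕ} {β : Type*} [AddCommMonoid β] (F : (Fin (l + 1) → Fin n) → β) :
    ∑ s, F s = ∑ i, ∑ u : Fin l → Fin n, F (Fin.cons i u) := by
  rw [← (Fin.consEquiv fun _ => Fin n).sum_comp, Fintype.sum_prod_type]
  rfl

theorem sum_snoc {l : ℕ} {β : Type*} [AddCommMonoid β] (F : (Fin (l + 1) → Fin n) → β) :
    ∑ s, F s = ∑ i, ∑ u : Fin l → Fin n, F (Fin.snoc u i) := by
  rw [← (Fin.snocEquiv fun _ => Fin n).sum_comp, Fintype.sum_prod_type]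
  rfl

theorem sum_append {l m : ℕ} {β : Type*} [AddCommMonoid β] (F : (Fin (l + m) → Fin n) → β) :
    ∑ s, F s = ∑ a : Fin l → Fin n, ∑ w : Fin m → Fin n, F (Fin.append a w) := by
  rw [← (Fin.appendEquiv l m).sum_comp, Fintype.sum_prod_type]
  rfl

theorem mixedMap_pow_apply (a b : Fin n → Matrix (Fin k) (Fin k) ℂ) (N : ℕ)
    (X : Matrix (Fin k) (Fin k) ℂ) :
    (mixedMap a b ^ N) X = ∑ μ : Fin N → Fin n, monomial a μ * X * (monomial b μ)ᴴ := by
  induction N with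
  | zero => simp
  | succ N ih =>
    rw [pow_succ', Module.End.mul_apply, ih, mixedMap_apply, sum_cons]
    refine Finset.sum_congr rfl fun i _ => ?_
    rw [Finset.mul_sum, Finset.sum_mul]
    refine Finset.sum_congr rfl fun u _ => ?_
    simp only [monomial_cons, Matrix.conjTranspose_mul, mul_assoc]

theorem transferMap_pow_apply (v : Fin n → Matrix (Fin k) (Fin k) ℂ) (N : ℕ)
    (X : Matrix (Fin k) (Fin k) ℂ) :
    (transferMap v ^ N) X = ∑ μ : Fin N → Fin n, monomial v μ * X * (monomial v μ)ᴴ :=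
  mixedMap_pow_apply v v N X

theorem sum_norm_monomial_sq_le (v : Fin n → Matrix (Fin k) (Fin k) ℂ) (N : ℕ) :
    ∑ μ : Fin N → Fin n, ‖monomial v μ‖ ^ 2 ≤ k * ‖(transferMap v ^ N) 1‖ := by
  calc ∑ μ : Fin N → Fin n, ‖monomial v μ‖ ^ 2
      ≤ ∑ μ : Fin N → Fin n, (monomial v μ * (monomial v μ)ᴴ).trace.re :=
        Finset.sum_le_sum fun μ _ => norm_sq_le_re_trace _
    _ = ((transferMap v ^ N) 1).trace.re := by
        simp [transferMap_pow_apply, Matrix.trace_sum]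
    _ ≤ ‖((transferMap v ^ N) 1).trace‖ := Complex.re_le_norm _
    _ ≤ _ := norm_trace_le _

/-- Cauchy–Schwarz: the powers of a mixed map are controlled by those of the two transfer maps. -/
theorem norm_mixedMap_pow_sq_le (a b : Fin n → Matrix (Fin k) (Fin k) ℂ) (N : ℕ)
    (X : Matrix (Fin k) (Fin k) ℂ) :
    ‖(mixedMap a b ^ N) X‖ ^ 2 ≤
      (k * ‖(transferMap a ^ N) 1‖) * (k * ‖(transferMap b ^ N) 1‖) * ‖X‖ ^ 2 := by
  have h1 : ‖(mixedMap a b ^ N) X‖ ≤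
      (∑ μ : Fin N → Fin n, ‖monomial a μ‖ * ‖monomial b μ‖) * ‖X‖ := by
    rw [mixedMap_pow_apply, Finset.sum_mul]
    refine (norm_sum_le _ _).trans (Finset.sum_le_sum fun μ _ => ?_)
    calc _ ≤ ‖monomial a μ‖ * ‖X‖ * ‖(monomial b μ)ᴴ‖ :=
          (norm_mul_le _ _).trans (mul_le_mul_of_nonneg_right (norm_mul_le _ _) (norm_nonneg _))
      _ = _ := by rw [Matrix.l2_opNorm_conjTranspose]; ring
  calc ‖(mixedMap a b ^ N) X‖ ^ 2
      ≤ ((∑ μ : Fin N → Fin n, ‖monomial a μ‖ * ‖monomial b μ‖) * ‖X‖) ^ 2 := by gcongr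
    _ = (∑ μ : Fin N → Fin n, ‖monomial a μ‖ * ‖monomial b μ‖) ^ 2 * ‖X‖ ^ 2 := by ring
    _ ≤ ((∑ μ : Fin N → Fin n, ‖monomial a μ‖ ^ 2) *
          (∑ μ : Fin N → Fin n, ‖monomial b μ‖ ^ 2)) * ‖X‖ ^ 2 := by
        gcongr
        exact Finset.sum_mul_sq_le_sq_mul_sq _ _ _
    _ ≤ _ := by
        gcongr
        · exact sum_norm_monomial_sq_le a N
        · exact sum_norm_monomial_sq_le b N

end Words

/-! ### Ampliation of subspaces and projections -/

section Ampliation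

variable {n : ℕ}

/-- Cutting a word into three pieces as a bijection. -/
def cutEquiv (x m N : ℕ) (h : x + m ≤ N) :
    (Fin N → Fin n) ≃ ((Fin x → Fin n) × (Fin m → Fin n)) × (Fin (N - m - x) → Fin n) where
  toFun := cut x m N h
  invFun t i :=
    if h₁ : (i : ℕ) < x then t.1.1 ⟨i, h₁⟩
    else if h₂ : (i : ℕ) < x + m then t.1.2 ⟨i - x, by omega⟩
    else t.2 ⟨i - (x + m), by omega⟩
  left_inv s := by
    funext i
    simp only [cut, subword]
    split_ifs <;> congr 1 <;> ext <;> simp <;> omega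
  right_inv t := by
    obtain ⟨⟨a, w⟩, b⟩ := t
    refine Prod.ext (Prod.ext ?_ ?_) ?_ <;> funext i <;> have := i.isLt <;>
      simp only [cut, subword]
    · simp
    · simp
    · rw [dif_neg (by omega), dif_neg (by omega)]
      congr 1
      ext
      simp

/-- The word `t` with its letters at the sites `[x, x+m-1]` replaced by the word `w`. -/
def splice (x m N : ℕ) (t : Fin N → Fin n) (w : Fin m → Fin n) : Fin N → Fin n := fun i =>
  if h : x ≤ (i : ℕ) ∧ (i : ℕ) < x + m then w ⟨i - x, by omega⟩ else t i

theorem cutEquiv_symm_apply (x m N : ℕ) (h : x + m ≤ N) (t : Fin N → Fin n) (w : Fin m → Fin n) :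
    (cutEquiv x m N h).symm (((cut x m N h t).1.1, w), (cut x m N h t).2) = splice x m N t w := by
  funext i
  simp only [cutEquiv, cut, subword, splice, Equiv.coe_fn_symm_mk]
  split_ifs <;> first | omega | rfl | (congr 1; ext; simp <;> omega)

/-- The vector on the sites `[x, x+m-1]` obtained from `f` by fixing the letters `a` to the left
and `b` to the right. -/
def slice (x m N : ℕ) (h : x + m ≤ N) (a : Fin x → Fin n) (b : Fin (N - m - x) → Fin n)
    (f : ChainSpace n N) : ChainSpace n m :=
  WithLp.toLp 2 fun w => f ((cutEquiv x m N h).symm ((a, w), b))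

theorem inner_eq_sum_slice (x m N : ℕ) (h : x + m ≤ N) (f g : ChainSpace n N) :
    inner ℂ f g = ∑ a, ∑ b, inner ℂ (slice x m N h a b f) (slice x m N h a b g) := by
  simp only [PiLp.inner_apply, slice]
  rw [← (cutEquiv x m N h).symm.sum_comp, Fintype.sum_prod_type, Fintype.sum_prod_type]
  exact Finset.sum_congr rfl fun a _ => Finset.sum_comm

theorem slice_productVector (x m N : ℕ) (h : x + m ≤ N) (a : Fin x → Fin n)
    (b : Fin (N - m - x) → Fin n) (ξ : ChainSpace n x) (ω : ChainSpace n m)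
    (η : ChainSpace n (N - m - x)) :
    slice x m N h a b (productVector x m N h ξ ω η) = (ξ a * η b) • ω := by
  ext w
  have : cut x m N h ((cutEquiv x m N h).symm ((a, w), b)) = ((a, w), b) :=
    (cutEquiv x m N h).apply_symm_apply _
  simp only [slice, productVector, this, PiLp.smul_apply, smul_eq_mul]
  ring

theorem eq_sum_productVector_slice (x m N : ℕ) (h : x + m ≤ N) (f : ChainSpace n N) :
    f = ∑ a, ∑ b, productVector x m N h (EuclideanSpace.single a 1) (slice x m N h a b f)
      (EuclideanSpace.single b 1) := by
  ext s
  simp only [productVector, slice, WithLp.ofLp_sum, Finset.sum_apply, PiLp.single_apply]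
  rw [Finset.sum_eq_single (cut x m N h s).1.1, Finset.sum_eq_single (cut x m N h s).2]
  · simp only [if_true, one_mul, mul_one]
    exact congrArg f ((cutEquiv x m N h).symm_apply_apply s).symm
  · intro b _ hb
    simp [hb.symm]
  · simp
  · intro a _ ha
    simp [ha.symm]
  · simp

theorem mem_ampliateSubspace_iff_slice {x m N : ℕ} {h : x + m ≤ N}
    {D : Submodule ℂ (ChainSpace n m)} {f : ChainSpace n N} :
    f ∈ ampliateSubspace x m N h D ↔ ∀ a b, slice x m N h a b f ∈ D := by
  constructor
  · intro hf a b
    refine Submodule.span_induction (p := fun f _ => slice x m N h a b f ∈ D) ?_ ?_ ?_ ?_ hf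
    · rintro _ ⟨ξ, η, ω, hω, rfl⟩
      rw [slice_productVector]
      exact D.smul_mem _ hω
    · exact D.zero_mem
    · intro f g _ _ hf hg
      exact D.add_mem hf hg
    · intro c f _ hf
      exact D.smul_mem c hf
  · intro hf
    rw [eq_sum_productVector_slice x m N h f]
    exact Submodule.sum_mem _ fun a _ => Submodule.sum_mem _ fun b _ =>
      Submodule.subset_span ⟨_, _, _, hf a b, rfl⟩

theorem mem_ampliateSubspace_iff {x m N : ℕ} (h : x + m ≤ N)
    {D : Submodule ℂ (ChainSpace n m)} {f : ChainSpace n N} :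
    f ∈ ampliateSubspace x m N h D ↔
      ∀ t, (WithLp.toLp 2 fun w => f (splice x m N t w) : ChainSpace n m) ∈ D := by
  rw [mem_ampliateSubspace_iff_slice]
  constructor
  · intro hf t
    simpa only [slice, cutEquiv_symm_apply] using hf (cut x m N h t).1.1 (cut x m N h t).2
  · intro hf a b
    -- A word with prescribed outer letters exists once a middle word does; otherwise the
    -- middle space is trivial.
    rcases isEmpty_or_nonempty (Fin m → Fin n) with hE | ⟨⟨w₀⟩⟩
    · have : slice x m N h a b f = 0 := by
        ext w
        exact hE.elim w
      rw [this]
      exact D.zero_mem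
    · have ht : cut x m N h ((cutEquiv x m N h).symm ((a, w₀), b)) = ((a, w₀), b) :=
        (cutEquiv x m N h).apply_symm_apply _
      have := hf ((cutEquiv x m N h).symm ((a, w₀), b))
      simpa only [← cutEquiv_symm_apply x m N h, ht, slice] using this

theorem slice_ampliate (x m N : ℕ) (h : x + m ≤ N) (A : ChainSpace n m →L[ℂ] ChainSpace n m)
    (a : Fin x → Fin n) (b : Fin (N - m - x) → Fin n) (f : ChainSpace n N) :
    slice x m N h a b (ampliate x m N h A f) = A (slice x m N h a b f) := by
  have hc : ∀ t : ((Fin x → Fin n) × (Fin m → Fin n)) × (Fin (N - m - x) → Fin n),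
      cut x m N h ((cutEquiv x m N h).symm t) = t :=
    (cutEquiv x m N h).apply_symm_apply
  have hA : A (slice x m N h a b f) = WithLp.toLp 2
      ((Matrix.toEuclideanCLM (𝕜 := ℂ) (n := Fin m → Fin n)).symm A *ᵥ
        (slice x m N h a b f).ofLp) := by
    conv_lhs => rw [← (Matrix.toEuclideanCLM (𝕜 := ℂ) (n := Fin m → Fin n)).apply_symm_apply A]
    ext w
    rw [Matrix.ofLp_toEuclideanCLM]
  rw [hA]
  ext w
  simp only [slice, ampliate, Matrix.ofLp_toEuclideanCLM, Matrix.mulVec, dotProduct]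
  rw [← (cutEquiv x m N h).symm.sum_comp, Fintype.sum_prod_type, Fintype.sum_prod_type]
  simp only [Matrix.submatrix_apply, hc, Matrix.kroneckerMap_apply]
  rw [Finset.sum_eq_single a]
  · refine Finset.sum_congr rfl fun w' _ => ?_
    rw [Finset.sum_eq_single b]
    · simp
    · intro b' _ hb
      simp [Matrix.one_apply_ne hb.symm]
    · simp
  · intro a' _ ha
    simp [Matrix.one_apply_ne ha.symm]
  · simp

theorem projection_apply_mem {l : ℕ} (D : Submodule ℂ (ChainSpace n l)) (f : ChainSpace n l) :
    projection D f ∈ D := by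
  have : D.HasOrthogonalProjection := Submodule.HasOrthogonalProjection.ofCompleteSpace D
  exact D.starProjection_apply_mem f

theorem inner_projection {l : ℕ} (D : Submodule ℂ (ChainSpace n l)) {u : ChainSpace n l}
    (hu : u ∈ D) (f : ChainSpace n l) : inner ℂ u (projection D f) = inner ℂ u f := by
  have : D.HasOrthogonalProjection := Submodule.HasOrthogonalProjection.ofCompleteSpace D
  have h := D.starProjection_inner_eq_zero f u hu
  rw [inner_eq_zero_symm, inner_sub_right, sub_eq_zero] at h
  exact h.symm

theorem norm_projection_apply_le {l : ℕ} (D : Submodule ℂ (ChainSpace n l)) (f : ChainSpace n l) :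
    ‖projection D f‖ ≤ ‖f‖ := by
  have : D.HasOrthogonalProjection := Submodule.HasOrthogonalProjection.ofCompleteSpace D
  exact D.norm_starProjection_apply_le f

/-- The ampliation of the projection onto `D` is the projection onto the ampliation of `D`. -/
theorem ampliate_projection (x m N : ℕ) (h : x + m ≤ N) (D : Submodule ℂ (ChainSpace n m)) :
    ampliate x m N h (projection D) = projection (ampliateSubspace x m N h D) := by
  ext1 f
  have : (ampliateSubspace x m N h D).HasOrthogonalProjection :=
    Submodule.HasOrthogonalProjection.ofCompleteSpace _
  refine (Submodule.eq_starProjection_of_mem_of_inner_eq_zero ?_ ?_).symm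
  · rw [mem_ampliateSubspace_iff_slice]
    intro a b
    rw [slice_ampliate]
    exact projection_apply_mem D _
  · intro u hu
    rw [mem_ampliateSubspace_iff_slice] at hu
    rw [inner_eq_zero_symm, inner_sub_right, sub_eq_zero, inner_eq_sum_slice x m N h,
      inner_eq_sum_slice x m N h]
    refine Finset.sum_congr rfl fun a _ => Finset.sum_congr rfl fun b _ => ?_
    rw [slice_ampliate, inner_projection D (hu a b)]

/-- The first `N` of `N + 1` sites. -/
theorem mem_ampliateSubspace_snoc {N : ℕ} (h : 0 + N ≤ N + 1)
    {D : Submodule ℂ (ChainSpace n N)} {f : ChainSpace n (N + 1)} :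
    f ∈ ampliateSubspace 0 N (N + 1) h D ↔
      ∀ b : Fin n, (WithLp.toLp 2 fun u => f (Fin.snoc u b : Fin (N + 1) → Fin n) :
        ChainSpace n N) ∈ D := by
  have key : ∀ (t : Fin (N + 1) → Fin n) (u : Fin N → Fin n),
      splice 0 N (N + 1) t u = (Fin.snoc u (t (Fin.last N)) : Fin (N + 1) → Fin n) := by
    intro t u
    funext i
    refine Fin.lastCases ?_ (fun i => ?_) i <;> simp [splice]
  rw [mem_ampliateSubspace_iff]
  simp only [key]
  exact ⟨fun H b => by simpa using H fun _ => b, fun H t => H _⟩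

/-- The last `m` of `x + m` sites. -/
theorem mem_ampliateSubspace_append {x m : ℕ} (h : x + m ≤ x + m)
    {D : Submodule ℂ (ChainSpace n m)} {f : ChainSpace n (x + m)} :
    f ∈ ampliateSubspace x m (x + m) h D ↔
      ∀ a : Fin x → Fin n, (WithLp.toLp 2 fun w => f (Fin.append a w) : ChainSpace n m) ∈ D := by
  have key : ∀ (t : Fin (x + m) → Fin n) (w : Fin m → Fin n),
      splice x m (x + m) t w = Fin.append (fun i => t (Fin.castAdd m i)) w := by
    intro t u
    funext i
    refine Fin.addCases (fun i => ?_) (fun i => ?_) i <;> simp [splice]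
  rw [mem_ampliateSubspace_iff]
  simp only [key]
  refine ⟨fun H a => ?_, fun H t => H _⟩
  rcases isEmpty_or_nonempty (Fin m → Fin n) with hE | ⟨⟨w₀⟩⟩
  · have : (WithLp.toLp 2 fun w => f (Fin.append a w) : ChainSpace n m) = 0 := by
      ext w
      exact hE.elim w
    rw [this]
    exact D.zero_mem
  · simpa using H (Fin.append a w₀)

end Ampliation

/-! ### The intersection property -/

section Intersection

variable {n k : ℕ}

theorem mem_groundSpace_iff {v : Fin n → Matrix (Fin k) (Fin k) ℂ} {l : ℕ} {f : ChainSpace n l} :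
    f ∈ groundSpace v l ↔
      ∃ X : Matrix (Fin k) (Fin k) ℂ, ∀ u, f u = (X * (monomial v u)ᴴ).trace := by
  constructor
  · rintro ⟨X, rfl⟩
    exact ⟨X, fun u => rfl⟩
  · rintro ⟨X, hX⟩
    refine ⟨X, ?_⟩
    ext u
    exact (hX u).symm

theorem splice_add {x m y : ℕ} (t : Fin (x + m + y) → Fin n) (w : Fin m → Fin n) :
    splice x m (x + m + y) t w =
      Fin.append (Fin.append (fun i => t (Fin.castAdd y (Fin.castAdd m i))) w)
        fun i => t (Fin.natAdd (x + m) i) := by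
  funext i
  refine Fin.addCases (fun i => Fin.addCases (fun i => ?_) (fun i => ?_) i) (fun i => ?_) i
  all_goals simp [splice]

theorem groundSpace_le_ampliateSubspace (v : Fin n → Matrix (Fin k) (Fin k) ℂ) (x m N : ℕ)
    (h : x + m ≤ N) : groundSpace v N ≤ ampliateSubspace x m N h (groundSpace v m) := by
  intro f hf
  obtain ⟨X, hX⟩ := mem_groundSpace_iff.1 hf
  obtain ⟨y, rfl⟩ := Nat.exists_eq_add_of_le h
  rw [mem_ampliateSubspace_iff]
  intro t
  rw [mem_groundSpace_iff]
  refine ⟨(monomial v fun i => t (Fin.castAdd y (Fin.castAdd m i)))ᴴ * X *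
    (monomial v fun i => t (Fin.natAdd (x + m) i))ᴴ, fun w => ?_⟩
  simp only [hX, splice_add, monomial_append, Matrix.conjTranspose_mul]
  rw [← mul_assoc, ← mul_assoc, Matrix.trace_mul_comm]
  simp only [mul_assoc]

theorem monomial_tail_append {l m : ℕ} (hl : 0 < l) (v : Fin n → Matrix (Fin k) (Fin k) ℂ)
    (a : Fin l → Fin n) (w : Fin (m + 1) → Fin n) :
    monomial v (Fin.tail (Fin.append (m := l) (n := m + 1) a w)) =
      (List.ofFn fun i => v (a i)).tail.prod * monomial v w := by
  have h1 : ∀ (N : ℕ) (s : Fin (N + 1) → Fin n),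
      monomial v (Fin.tail s) = (List.ofFn fun i => v (s i)).tail.prod := by
    intro N s
    rw [List.ofFn_succ, List.tail_cons]
    rfl
  have h2 : (fun i => v (Fin.append a w i)) = Fin.append (fun i => v (a i)) fun i => v (w i) := by
    ext1 i
    refine Fin.addCases (fun i => ?_) (fun i => ?_) i <;> simp
  have hne : (List.ofFn fun i => v (a i)) ≠ [] := by
    intro h0
    have := congrArg List.length h0
    simp at this
    omega
  rw [h1 (l + m)]
  change (List.ofFn fun i : Fin (l + (m + 1)) => v (Fin.append a w i)).tail.prod = _
  rw [h2, List.ofFn_fin_append, List.tail_append_of_ne_nil hne, List.prod_append, monomial]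

/-- A vector on `N + 1` sites whose restrictions to the first `N` and to the last `N` sites are
matrix product vectors is itself a matrix product vector. -/
theorem mem_groundSpace_succ {v : Fin n → Matrix (Fin k) (Fin k) ℂ} {m₂ m₃ r : ℕ} (hm₂ : 1 ≤ m₂)
    (h_shift : ShiftCondition v m₂ m₃) (hr : m₃ ≤ r) {f : ChainSpace n (m₂ + r + 1)}
    (hsnoc : ∀ b : Fin n, (WithLp.toLp 2 fun u =>
      f (Fin.snoc u b : Fin (m₂ + r + 1) → Fin n) : ChainSpace n (m₂ + r)) ∈ groundSpace v (m₂ + r))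
    (hcons : ∀ a : Fin n, (WithLp.toLp 2 fun u =>
      f (Fin.cons a u : Fin (m₂ + r + 1) → Fin n) : ChainSpace n (m₂ + r)) ∈
        groundSpace v (m₂ + r)) :
    f ∈ groundSpace v (m₂ + r + 1) := by
  simp only [mem_groundSpace_iff] at hsnoc hcons
  choose Y hY using hsnoc
  choose V hV using hcons
  obtain ⟨X, hXm, hXu, hX⟩ := h_shift
  obtain ⟨c, hc⟩ := (Submodule.mem_span_range_iff_exists_fun ℂ).1 hXm
  have hdet : IsUnit X.det := (Matrix.isUnit_iff_isUnit_det X).1 hXu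
  -- `f` on words with a fixed initial segment of length `m₂`
  obtain ⟨U, hU⟩ : ∃ U : (Fin m₂ → Fin n) → Matrix (Fin k) (Fin k) ℂ,
      ∀ a (w : Fin (r + 1) → Fin n),
        f (Fin.append a w : Fin (m₂ + (r + 1)) → Fin n) = (U a * (monomial v w)ᴴ).trace := by
    refine ⟨fun a => ((List.ofFn fun i => v (a i)).tail.prod)ᴴ * V (a ⟨0, hm₂⟩), fun a w => ?_⟩
    have h0 := hV ((Fin.append (m := m₂) (n := r + 1) a w) 0)
      (Fin.tail (Fin.append (m := m₂) (n := r + 1) a w))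
    simp only [Fin.cons_self_tail] at h0
    refine h0.trans ?_
    have h1 : (Fin.append (m := m₂) (n := r + 1) a w) 0 = a ⟨0, hm₂⟩ :=
      Fin.append_left a w ⟨0, hm₂⟩
    rw [h1, monomial_tail_append hm₂, Matrix.conjTranspose_mul, ← mul_assoc, Matrix.trace_mul_comm,
      ← mul_assoc]
  -- Averaging over the initial segment with the coefficients of `X`.
  have key : ∀ b, ∀ σ ∈ monomialSpan v r,
      (Xᴴ * Y b * σᴴ).trace = ((∑ a, star (c a) • U a) * (v b)ᴴ * σᴴ).trace := by
    intro b σ hσ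
    refine Submodule.span_induction (p := fun σ _ => (Xᴴ * Y b * σᴴ).trace =
      ((∑ a, star (c a) • U a) * (v b)ᴴ * σᴴ).trace) ?_ (by simp) ?_ ?_ hσ
    · rintro _ ⟨w, rfl⟩
      have hterm : ∀ a, ((monomial v a)ᴴ * Y b * (monomial v w)ᴴ).trace =
          (U a * (v b)ᴴ * (monomial v w)ᴴ).trace := by
        intro a
        have h1 := hY b (Fin.append a w)
        have h2 := hU a (Fin.snoc w b)
        have h3 : (Fin.snoc (Fin.append a w : Fin (m₂ + r) → Fin n) b : Fin (m₂ + r + 1) → Fin n) =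
            (Fin.append a (Fin.snoc w b : Fin (r + 1) → Fin n) : Fin (m₂ + (r + 1)) → Fin n) :=
          (Fin.append_snoc a w b).symm
        simp only [h3, monomial_append, monomial_snoc, Matrix.conjTranspose_mul] at h1 h2
        rw [mul_assoc, Matrix.trace_mul_comm, mul_assoc, mul_assoc, ← h2]
        exact h1.symm
      rw [← hc]
      simp only [Matrix.conjTranspose_sum, Matrix.conjTranspose_smul, Finset.sum_mul,
        Matrix.smul_mul, Matrix.trace_sum, Matrix.trace_smul, hterm]
    · intro σ τ _ _ h1 h2
      simp only [Matrix.conjTranspose_add, Matrix.mul_add, Matrix.trace_add, h1, h2]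
    · intro d σ _ h1
      simp only [Matrix.conjTranspose_smul, Matrix.mul_smul, Matrix.trace_smul, h1]
  rw [mem_groundSpace_iff]
  refine ⟨(Xᴴ)⁻¹ * ∑ a, star (c a) • U a, fun s => ?_⟩
  obtain ⟨u, b, rfl⟩ : ∃ (u : Fin (m₂ + r) → Fin n) (b : Fin n),
      s = (Fin.snoc u b : Fin (m₂ + r + 1) → Fin n) :=
    ⟨Fin.init s, s (Fin.last _), (Fin.snoc_init_self s).symm⟩
  have hσ : X⁻¹ * monomial v u ∈ monomialSpan v r := by
    apply hX r hr
    rw [add_comm r m₂]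
    exact monomial_mem_monomialSpan v u
  have h1 := key b _ hσ
  have h2 : monomial v u = X * (X⁻¹ * monomial v u) := by
    rw [← mul_assoc, Matrix.mul_nonsing_inv X hdet, one_mul]
  calc f (Fin.snoc u b : Fin (m₂ + r + 1) → Fin n) = (Y b * (monomial v u)ᴴ).trace := hY b u
    _ = (Xᴴ * Y b * (X⁻¹ * monomial v u)ᴴ).trace := by
      conv_lhs => rw [h2]
      rw [Matrix.conjTranspose_mul X, ← mul_assoc, Matrix.trace_mul_comm, mul_assoc]
    _ = _ := by
      rw [h1, monomial_snoc, Matrix.conjTranspose_mul, Matrix.conjTranspose_mul,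
        Matrix.conjTranspose_nonsing_inv, ← mul_assoc, Matrix.trace_mul_comm]
      simp only [mul_assoc]

theorem snoc_splice {x m N : ℕ} (h : x + m ≤ N) (t : Fin N → Fin n) (b : Fin n)
    (w : Fin m → Fin n) :
    (Fin.snoc (splice x m N t w) b : Fin (N + 1) → Fin n) =
      splice x m (N + 1) (Fin.snoc t b : Fin (N + 1) → Fin n) w := by
  funext i
  refine Fin.lastCases ?_ (fun i => ?_) i <;> simp [splice]
  intros
  omega

theorem cons_splice {x m N : ℕ} (t : Fin N → Fin n) (a : Fin n)
    (w : Fin m → Fin n) :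
    (Fin.cons a (splice x m N t w) : Fin (N + 1) → Fin n) =
      splice (x + 1) m (N + 1) (Fin.cons a t : Fin (N + 1) → Fin n) w := by
  funext i
  refine Fin.cases ?_ (fun i => ?_) i
  · simp [splice]
  · simp only [Fin.cons_succ, splice, Fin.val_succ]
    have : (x ≤ (i : ℕ) ∧ (i : ℕ) < x + m) ↔ (x + 1 ≤ (i : ℕ) + 1 ∧ (i : ℕ) + 1 < x + 1 + m) := by
      omega
    simp only [this, Nat.add_sub_add_right]

theorem intersectionProperty_groundSpace {v : Fin n → Matrix (Fin k) (Fin k) ℂ} {m₂ m₃ : ℕ}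
    (hn : 1 ≤ n) (hm₂ : 1 ≤ m₂) (h_shift : ShiftCondition v m₂ m₃) :
    IntersectionProperty (groundSpace v) (m₂ + m₃) := by
  intro N hN
  refine le_antisymm (le_iInf₂ fun x h => groundSpace_le_ampliateSubspace v x _ N h) ?_
  induction N, hN using Nat.le_induction with
  | base =>
    refine iInf₂_le_of_le 0 (by omega) fun f hf => ?_
    rw [mem_ampliateSubspace_iff] at hf
    have := hf fun _ => ⟨0, hn⟩
    have h2 : ∀ w, splice 0 (m₂ + m₃) (m₂ + m₃) (fun _ => (⟨0, hn⟩ : Fin n)) w = w := by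
      intro w
      funext i
      simp [splice]
    simpa only [h2] using this
  | succ N hN ih =>
    intro f hf
    simp only [Submodule.mem_iInf, mem_ampliateSubspace_iff] at hf
    obtain ⟨r, rfl⟩ := Nat.exists_eq_add_of_le ((Nat.le_add_right m₂ m₃).trans hN)
    refine mem_groundSpace_succ hm₂ h_shift (by omega) (fun b => ih ?_) fun a => ih ?_
    · simp only [Submodule.mem_iInf, mem_ampliateSubspace_iff]
      intro x h t
      simp only [snoc_splice h]
      exact hf x (by omega) _
    · simp only [Submodule.mem_iInf, mem_ampliateSubspace_iff]
      intro x h t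
      simp only [cons_splice]
      exact hf (x + 1) (by omega) _

end Intersection

/-! ### Powers of linear maps and block decomposition of the transfer map -/

section Powers

/-- A linear map all of whose eigenvalues lie in the open unit disc has exponentially decaying
powers, by Gelfand's formula. -/
theorem exists_norm_pow_le {V : Type*} [NormedAddCommGroup V] [NormedSpace ℂ V]
    [FiniteDimensional ℂ V] [Nontrivial V] (S : Module.End ℂ V)
    (hS : ∀ (z : ℂ) (A : V), 1 ≤ ‖z‖ → S A = z • A → A = 0) :
    ∃ C s : ℝ, 0 < C ∧ 0 < s ∧ s < 1 ∧ ∀ (N : ℕ) (A : V), ‖(S ^ N) A‖ ≤ C * s ^ N * ‖A‖ := by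
  have : CompleteSpace V := FiniteDimensional.complete ℂ V
  set a : V →L[ℂ] V := Module.End.toContinuousLinearMap V S with ha
  have hrad : spectralRadius ℂ a < ((1 : NNReal) : ENNReal) := by
    refine spectrum.spectralRadius_lt_of_forall_lt a fun z hz => ?_
    rw [ha, AlgEquiv.spectrum_eq, ← Module.End.hasEigenvalue_iff_mem_spectrum] at hz
    obtain ⟨A, hA⟩ := hz.exists_hasEigenvector
    by_contra hlt
    refine hA.2 (hS z A ?_ hA.apply_eq_smul)
    exact_mod_cast not_lt.1 hlt
  obtain ⟨s, hs₁, hs₂⟩ := ENNReal.lt_iff_exists_nnreal_btwn.1 hrad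
  have hs1 : s < 1 := by exact_mod_cast hs₂
  have hs0 : 0 < s := by
    have : (0 : ENNReal) < s := lt_of_le_of_lt zero_le hs₁
    exact_mod_cast this
  have hev :=
    (spectrum.pow_nnnorm_pow_one_div_tendsto_nhds_spectralRadius a).eventually_lt_const hs₁
  obtain ⟨n₀, hn₀⟩ := (hev.and (eventually_ge_atTop 1)).exists_forall_of_atTop
  have hs0' : (0 : ℝ) < s := hs0
  refine ⟨1 + ∑ i ∈ Finset.range n₀, ‖a ^ i‖ / (s : ℝ) ^ i, s, by positivity, hs0', hs1,
    fun N A => ?_⟩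
  have hpow : (S ^ N) A = (a ^ N) A := by
    rw [ha, ← map_pow]
    rfl
  have hbound : ‖a ^ N‖ ≤ (1 + ∑ i ∈ Finset.range n₀, ‖a ^ i‖ / (s : ℝ) ^ i) * (s : ℝ) ^ N := by
    rcases lt_or_ge N n₀ with hN | hN
    · have h1 := Finset.single_le_sum (f := fun i => ‖a ^ i‖ / (s : ℝ) ^ i)
        (fun i _ => by positivity) (Finset.mem_range.2 hN)
      calc ‖a ^ N‖ = ‖a ^ N‖ / (s : ℝ) ^ N * (s : ℝ) ^ N := by field_simp
        _ ≤ _ := by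
          gcongr
          exact h1.trans (by linarith)
    · obtain ⟨h1, h2⟩ := hn₀ N hN
      have h3 : (‖a ^ N‖₊ : ENNReal) ≤ (s : ENNReal) ^ N := by
        have h4 := ENNReal.rpow_le_rpow h1.le (Nat.cast_nonneg N)
        rw [← ENNReal.rpow_mul, one_div, inv_mul_cancel₀ (by positivity), ENNReal.rpow_one,
          ENNReal.rpow_natCast] at h4
        exact h4
      have h5 : ‖a ^ N‖ ≤ (s : ℝ) ^ N := by exact_mod_cast h3
      have h6 : 0 ≤ ∑ i ∈ Finset.range n₀, ‖a ^ i‖ / (s : ℝ) ^ i := by positivity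
      nlinarith [pow_pos hs0' N]
  rw [hpow]
  exact ((a ^ N).le_opNorm A).trans (by gcongr)

/-- If `z ^ N • B` converges and `|z| ≥ 1`, then `z • B = B`. -/
theorem smul_eq_self_of_tendsto_pow_smul {V : Type*} [NormedAddCommGroup V] [NormedSpace ℂ V]
    {z : ℂ} {B L : V} (hz : 1 ≤ ‖z‖)
    (h : Tendsto (fun N : ℕ => z ^ N • B) atTop (𝓝 L)) : z • B = B ∧ L = B := by
  have h1 : Tendsto (fun N : ℕ => z • z ^ N • B) atTop (𝓝 (z • L)) := h.const_smul z
  have h2 : Tendsto (fun N : ℕ => z • z ^ N • B) atTop (𝓝 L) := by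
    refine ((tendsto_add_atTop_iff_nat 1).2 h).congr fun N => ?_
    rw [pow_succ', mul_smul]
  have hL : (z - 1) • L = 0 := by
    rw [sub_smul, one_smul, sub_eq_zero]
    exact tendsto_nhds_unique h1 h2
  rcases smul_eq_zero.1 hL with h3 | h3
  · have h4 : z = 1 := sub_eq_zero.1 h3
    subst h4
    simp only [one_pow, one_smul] at h
    exact ⟨one_smul _ _, tendsto_nhds_unique h tendsto_const_nhds |>.symm ▸ rfl⟩
  · subst h3
    have h5 : ‖B‖ ≤ 0 := by
      refine ge_of_tendsto (by simpa using h.norm) (Eventually.of_forall fun N => ?_)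
      rw [norm_smul, norm_pow]
      exact le_mul_of_one_le_left (norm_nonneg _) (one_le_pow₀ hz)
    have h6 : B = 0 := norm_le_zero_iff.1 h5
    simp [h6]

end Powers

section Blocks

variable {n k : ℕ}

theorem conjTranspose_mixedMap (a b : Fin n → Matrix (Fin k) (Fin k) ℂ)
    (X : Matrix (Fin k) (Fin k) ℂ) : (mixedMap a b X)ᴴ = mixedMap b a Xᴴ := by
  simp [mixedMap_apply, Matrix.conjTranspose_sum, mul_assoc]

theorem conjTranspose_transferMap (v : Fin n → Matrix (Fin k) (Fin k) ℂ)
    (X : Matrix (Fin k) (Fin k) ℂ) : (transferMap v X)ᴴ = transferMap v Xᴴ :=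
  conjTranspose_mixedMap v v X

/-- A mixed map between two tuples, the product of whose transfer maps decays, has no eigenvalue
outside the open unit disc. -/
theorem eq_zero_of_mixedMap_eq_smul {a b : Fin n → Matrix (Fin k) (Fin k) ℂ}
    (hab : Tendsto (fun N : ℕ => ‖(transferMap a ^ N) 1‖ * ‖(transferMap b ^ N) 1‖) atTop (𝓝 0))
    {z : ℂ} (hz : 1 ≤ ‖z‖) {X : Matrix (Fin k) (Fin k) ℂ} (hX : mixedMap a b X = z • X) :
    X = 0 := by
  have hpow : ∀ N : ℕ, (mixedMap a b ^ N) X = z ^ N • X := by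
    intro N
    induction N with
    | zero => simp
    | succ N ih => rw [pow_succ', Module.End.mul_apply, ih, map_smul, hX, smul_smul, pow_succ]
  have h1 : ∀ N : ℕ, ‖X‖ ^ 2 ≤
      (k * k * ‖X‖ ^ 2) * (‖(transferMap a ^ N) 1‖ * ‖(transferMap b ^ N) 1‖) := by
    intro N
    have h := norm_mixedMap_pow_sq_le a b N X
    rw [hpow, norm_smul, norm_pow] at h
    calc ‖X‖ ^ 2 ≤ (‖z‖ ^ N * ‖X‖) ^ 2 := by
          gcongr
          exact le_mul_of_one_le_left (norm_nonneg _) (one_le_pow₀ hz)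
      _ ≤ _ := h
      _ = _ := by ring
  have h2 : ‖X‖ ^ 2 ≤ 0 := by
    have := hab.const_mul ((k : ℝ) * k * ‖X‖ ^ 2)
    rw [mul_zero] at this
    exact ge_of_tendsto this (Eventually.of_forall h1)
  have h3 : ‖X‖ = 0 := by
    have : ‖X‖ ^ 2 = 0 := le_antisymm h2 (by positivity)
    exact pow_eq_zero_iff (two_ne_zero) |>.1 this
  exact norm_eq_zero.1 h3

theorem TransferDecays.tendsto {w : Fin n → Matrix (Fin k) (Fin k) ℂ} (hw : TransferDecays w)
    (A : Matrix (Fin k) (Fin k) ℂ) :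
    Tendsto (fun N : ℕ => (transferMap w ^ N) A) atTop (𝓝 0) := by
  obtain ⟨c, s, hc, hs0, hs1, h⟩ := hw
  have h1 : Tendsto (fun N : ℕ => c * s ^ N * ‖A‖) atTop (𝓝 0) := by
    simpa using ((tendsto_pow_atTop_nhds_zero_of_lt_one hs0.le hs1).const_mul c).mul_const ‖A‖
  exact squeeze_zero_norm' ((eventually_ge_atTop 1).mono fun N hN => h A N hN) h1

/-- On an invariant subspace the compressed tuple has the same monomials. -/
theorem monomial_compress_mul {w : Fin n → Matrix (Fin k) (Fin k) ℂ}
    {r : Matrix (Fin k) (Fin k) ℂ} (hr : IsStarProjection r)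
    (hinv : ∀ μ, w μ * r = r * w μ * r) {N : ℕ} (u : Fin N → Fin n) :
    monomial (compress w r) u * r = monomial w u * r ∧
      r * (monomial w u * r) = monomial w u * r := by
  have hrr : r * r = r := hr.isIdempotentElem
  induction N with
  | zero => simp [hrr]
  | succ N ih =>
    obtain ⟨i, u, rfl⟩ : ∃ (i : Fin n) (t : Fin N → Fin n), u = Fin.cons i t :=
      ⟨u 0, Fin.tail u, (Fin.cons_self_tail u).symm⟩
    obtain ⟨h1, h2⟩ := ih u
    have h3 : w i * (monomial w u * r) = r * (w i * (monomial w u * r)) := by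
      calc w i * (monomial w u * r) = w i * r * (monomial w u * r) := by rw [mul_assoc (w i), h2]
        _ = r * w i * r * (monomial w u * r) := by rw [hinv]
        _ = _ := by rw [mul_assoc, mul_assoc, h2]
    rw [monomial_cons, monomial_cons]
    constructor
    · rw [mul_assoc, h1, compress, mul_assoc, h2, mul_assoc, ← h3, mul_assoc]
    · rw [mul_assoc (w i), ← h3]

theorem transferMap_compress_pow_apply {w : Fin n → Matrix (Fin k) (Fin k) ℂ}
    {r : Matrix (Fin k) (Fin k) ℂ} (hr : IsStarProjection r)
    (hinv : ∀ μ, w μ * r = r * w μ * r) (N : ℕ) :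
    (transferMap (compress w r) ^ N) r = (transferMap w ^ N) r := by
  have hrr : r * r = r := hr.isIdempotentElem
  have hrs : rᴴ = r := hr.isSelfAdjoint
  rw [transferMap_pow_apply, transferMap_pow_apply]
  refine Finset.sum_congr rfl fun u _ => ?_
  have key : ∀ m : Matrix (Fin k) (Fin k) ℂ, m * r * mᴴ = m * r * (m * r)ᴴ := by
    intro m
    rw [Matrix.conjTranspose_mul, hrs, ← mul_assoc, mul_assoc m r r, hrr]
  rw [key, (monomial_compress_mul hr hinv u).1, ← key]

/-- Decay passes from a tuple to its compression to an invariant subspace. -/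
theorem tendsto_transferMap_compress_one {w : Fin n → Matrix (Fin k) (Fin k) ℂ}
    {r : Matrix (Fin k) (Fin k) ℂ} (hr : IsStarProjection r)
    (hinv : ∀ μ, w μ * r = r * w μ * r) (hw : TransferDecays w) :
    Tendsto (fun N : ℕ => (transferMap (compress w r) ^ N) 1) atTop (𝓝 0) := by
  have hrr : r * r = r := hr.isIdempotentElem
  have hrs : rᴴ = r := hr.isSelfAdjoint
  refine (hw.tendsto r).congr' ((eventually_ge_atTop 1).mono fun N hN => ?_)
  rw [← transferMap_compress_pow_apply hr hinv]
  obtain ⟨M, rfl⟩ := Nat.exists_eq_add_of_le' hN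
  simp only [pow_succ, Module.End.mul_apply]
  congr 1
  simp only [transferMap_apply, compress, Matrix.conjTranspose_mul, hrs, mul_one]
  refine Finset.sum_congr rfl fun μ _ => ?_
  simp only [mul_assoc]
  rw [← mul_assoc r r, hrr, ← mul_assoc r r, hrr]

/-- If the `(r, r')` block of `v_μ X v_μ^*` only involves the `(r, r')` block of `X`, then the
eigenvalue equation for the transfer map restricts to that block. -/
theorem mixedMap_compress_eq_smul {v : Fin n → Matrix (Fin k) (Fin k) ℂ}
    {r r' : Matrix (Fin k) (Fin k) ℂ} (hr : IsStarProjection r) (hr' : IsStarProjection r')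
    {z : ℂ} {X : Matrix (Fin k) (Fin k) ℂ}
    (hX : r * transferMap v X * r' = z • (r * X * r'))
    (hblock : ∀ μ, r * v μ * X * (r' * v μ)ᴴ = r * v μ * (r * X * r') * (r' * v μ)ᴴ) :
    mixedMap (compress v r) (compress v r') (r * X * r') = z • (r * X * r') := by
  have hrr : r * r = r := hr.isIdempotentElem
  have hrr' : r' * r' = r' := hr'.isIdempotentElem
  have hrs' : r'ᴴ = r' := hr'.isSelfAdjoint
  rw [← hX, mixedMap_apply, transferMap_apply, Finset.mul_sum, Finset.sum_mul]
  refine Finset.sum_congr rfl fun μ _ => ?_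
  have h := hblock μ
  rw [Matrix.conjTranspose_mul, hrs'] at h
  calc compress v r μ * (r * X * r') * (compress v r' μ)ᴴ
      = r * v μ * (r * r) * X * (r' * r') * ((v μ)ᴴ * r') := by
        simp only [compress, Matrix.conjTranspose_mul, hrs', mul_assoc]
    _ = r * v μ * (r * X * r') * ((v μ)ᴴ * r') := by
        simp only [hrr, hrr', mul_assoc]
    _ = _ := by rw [← h]; simp only [mul_assoc]

end Blocks

/-! ### Peripheral spectrum of the transfer map -/

section Spectrum

variable {n k : ℕ} {p q : Matrix (Fin k) (Fin k) ℂ} {v : Fin n → Matrix (Fin k) (Fin k) ℂ}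

theorem mul_mul_eq_of_sandwich {R : Type*} [Ring R] {r r' V X W : R}
    (h₁ : (V - V * r) * X * W = 0) (h₂ : V * r * X * (W - r' * W) = 0) :
    V * X * W = V * (r * X * r') * W := by
  have : V * X * W = (V - V * r) * X * W + V * r * X * (W - r' * W) + V * (r * X * r') * W := by
    noncomm_ring
  rw [this, h₁, h₂, zero_add, zero_add]

theorem isStarProjection_mul_compl (hp : IsStarProjection p) (hq : IsStarProjection q)
    (hpq : p * q = q * p) : IsStarProjection (p * (1 - q)) :=
  hp.mul hq.one_sub (by rw [commute_iff_eq, mul_sub, sub_mul, hpq, mul_one, one_mul])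

namespace TransferCondition

theorem one_sub_p_mul (h : TransferCondition p q v) (μ : Fin n) :
    (1 - p) * v μ - (1 - p) * v μ * (1 - p) = 0 := by
  have : (1 - p) * v μ - (1 - p) * v μ * (1 - p) = v μ * p - p * v μ * p := by noncomm_ring
  rw [this, ← h.invariant_p, sub_self]

theorem mul_one_sub_q (h : TransferCondition p q v) (μ : Fin n) :
    v μ * (1 - q) = (1 - q) * v μ * (1 - q) := by
  have : v μ * (1 - q) = (1 - q) * v μ * (1 - q) + (q * v μ - q * v μ * q) := by noncomm_ring
  rw [this, ← h.invariant_q, sub_self, add_zero]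

theorem pq_mul (h : TransferCondition p q v) (μ : Fin n) :
    p * q * v μ - p * q * v μ * (p * q) = p * q * v μ * (1 - p) := by
  have h1 : p * q * v μ * p = p * q * v μ * (p * q) := by
    calc p * q * v μ * p = p * (q * v μ) * p := by rw [mul_assoc p q]
      _ = p * (q * v μ * q) * p := by rw [← h.invariant_q]
      _ = p * q * v μ * (q * p) := by simp only [mul_assoc]
      _ = _ := by rw [← h.commute]
  rw [← h1, mul_sub, mul_one]

theorem tendsto_compress_one_sub_p (h : TransferCondition p q v) :
    Tendsto (fun N : ℕ => (transferMap (compress v (1 - p)) ^ N) 1) atTop (𝓝 0) :=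
  h.decay_p.tendsto 1

theorem tendsto_compress_compl (h : TransferCondition p q v) (hp : IsStarProjection p)
    (hq : IsStarProjection q) :
    Tendsto (fun N : ℕ => (transferMap (compress v (p * (1 - q))) ^ N) 1) atTop (𝓝 0) := by
  have hqq : (1 - q) * (1 - q) = 1 - q := hq.one_sub.isIdempotentElem
  have hc : p * (1 - q) = (1 - q) * p := by rw [mul_sub, sub_mul, h.commute, mul_one, one_mul]
  have hr := isStarProjection_mul_compl hp hq h.commute
  have h1 : compress (compress v (1 - q)) (p * (1 - q)) = compress v (p * (1 - q)) := by
    funext μ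
    have h2 : p * (1 - q) * (1 - q) = p * (1 - q) := by rw [mul_assoc, hqq]
    have h3 : (1 - q) * (p * (1 - q)) = p * (1 - q) := by rw [← mul_assoc, ← hc, h2]
    calc p * (1 - q) * ((1 - q) * v μ * (1 - q)) * (p * (1 - q))
        = (p * (1 - q) * (1 - q)) * v μ * ((1 - q) * (p * (1 - q))) := by simp only [mul_assoc]
      _ = _ := by rw [h2, h3, compress]
  rw [← h1]
  refine tendsto_transferMap_compress_one hr (fun μ => ?_) h.decay_q
  have h4 : compress v (1 - q) μ * p = p * compress v (1 - q) μ * p := by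
    calc (1 - q) * v μ * (1 - q) * p = (1 - q) * v μ * (p * (1 - q)) := by rw [hc, mul_assoc]
      _ = (1 - q) * (v μ * p) * (1 - q) := by simp only [mul_assoc]
      _ = (1 - q) * (p * v μ * p) * (1 - q) := by rw [← h.invariant_p]
      _ = ((1 - q) * p) * v μ * (p * (1 - q)) := by simp only [mul_assoc]
      _ = (p * (1 - q)) * v μ * ((1 - q) * p) := by rw [← hc]
      _ = _ := by simp only [compress, mul_assoc]
  have h5 : (1 - q) * compress v (1 - q) μ = compress v (1 - q) μ := by
    rw [compress, ← mul_assoc, ← mul_assoc, hqq]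
  calc compress v (1 - q) μ * (p * (1 - q)) = compress v (1 - q) μ * p * (1 - q) := by
        rw [mul_assoc]
    _ = p * compress v (1 - q) μ * p * (1 - q) := by rw [← h4]
    _ = p * ((1 - q) * compress v (1 - q) μ) * p * (1 - q) := by rw [h5]
    _ = _ := by simp only [mul_assoc]

theorem tendsto_compress_pq (h : TransferCondition p q v) :
    ∃ (φ : Matrix (Fin k) (Fin k) ℂ →ₗ[ℂ] ℂ) (e : Matrix (Fin k) (Fin k) ℂ),
      φ (p * q) ≠ 0 ∧ e ≠ 0 ∧ ∀ A, Tendsto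
        (fun N : ℕ => (transferMap (compress v (p * q)) ^ N) A) atTop (𝓝 (φ A • e)) := by
  obtain ⟨c, s, φ, e, hc, hs0, hs1, hφ, he, hsφ, hse, hconv⟩ := h.spectral_pq
  refine ⟨φ, e, fun h0 => ?_, fun h0 => ?_, fun A => ?_⟩
  · have h1 : φ (1 - 0) = 0 := by
      have := hsφ.2.1
      rw [map_sub, h0, sub_zero] at this
      rw [sub_zero, this]
    have := hsφ.2.2 0 (IsStarProjection.zero _) h1
    rw [zero_mul] at this
    exact h.mul_ne_zero this.symm
  · have := hse.2.2 0 (IsStarProjection.zero _) (by rw [h0, zero_mul])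
    rw [zero_mul] at this
    exact h.mul_ne_zero this.symm
  · rw [tendsto_iff_norm_sub_tendsto_zero]
    have h1 : Tendsto (fun N : ℕ => c * s ^ N * ‖A‖) atTop (𝓝 0) := by
      simpa using ((tendsto_pow_atTop_nhds_zero_of_lt_one hs0.le hs1).const_mul c).mul_const ‖A‖
    exact squeeze_zero' (Eventually.of_forall fun N => norm_nonneg _)
      ((eventually_ge_atTop 1).mono fun N hN => hconv A N hN) h1

theorem add_compl (p q : Matrix (Fin k) (Fin k) ℂ) : (1 - p) + p * q + p * (1 - q) = 1 := by
  noncomm_ring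

/-- The range of `p` carries the peripheral spectrum: outside of it the transfer map has no
spectrum of modulus at least one. -/
theorem one_sub_p_mul_eq_zero (h : TransferCondition p q v) (hp : IsStarProjection p)
    (hq : IsStarProjection q) {z : ℂ} (hz : 1 ≤ ‖z‖) {X : Matrix (Fin k) (Fin k) ℂ}
    (hX : (1 - p) * transferMap v X = z • ((1 - p) * X)) : (1 - p) * X = 0 := by
  obtain ⟨φ, e, -, -, hpq⟩ := h.tendsto_compress_pq
  have d1 := h.tendsto_compress_one_sub_p.norm
  have d3 := (h.tendsto_compress_compl hp hq).norm
  have d2 := (hpq 1).norm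
  have r2 : IsStarProjection (p * q) := hp.mul hq h.commute
  have r3 := isStarProjection_mul_compl hp hq h.commute
  have hXr : ∀ r, (1 - p) * transferMap v X * r = z • ((1 - p) * X * r) := by
    intro r
    rw [hX, Matrix.smul_mul]
  have Y1 : (1 - p) * X * (1 - p) = 0 := by
    refine eq_zero_of_mixedMap_eq_smul (by simpa using d1.mul d1) hz
      (mixedMap_compress_eq_smul hp.one_sub hp.one_sub (hXr _) fun μ =>
        mul_mul_eq_of_sandwich ?_ ?_)
    · rw [h.one_sub_p_mul, zero_mul, zero_mul]
    · have h1 := congrArg Matrix.conjTranspose (h.one_sub_p_mul μ)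
      rw [Matrix.conjTranspose_sub, Matrix.conjTranspose_mul _ (1 - p), Matrix.conjTranspose_zero,
        show (1 - p)ᴴ = 1 - p from hp.one_sub.isSelfAdjoint] at h1
      rw [h1, mul_zero]
  have Y2 : (1 - p) * X * (p * q) = 0 := by
    refine eq_zero_of_mixedMap_eq_smul (by simpa using d1.mul d2) hz
      (mixedMap_compress_eq_smul hp.one_sub r2 (hXr _) fun μ =>
        mul_mul_eq_of_sandwich ?_ ?_)
    · rw [h.one_sub_p_mul, zero_mul, zero_mul]
    · have h1 := congrArg Matrix.conjTranspose (h.pq_mul μ)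
      rw [Matrix.conjTranspose_sub, Matrix.conjTranspose_mul _ (p * q),
        Matrix.conjTranspose_mul _ (1 - p), show (p * q)ᴴ = p * q from r2.isSelfAdjoint,
        show (1 - p)ᴴ = 1 - p from hp.one_sub.isSelfAdjoint] at h1
      rw [h1, ← mul_assoc, mul_assoc _ (1 - p) X, mul_assoc _ _ (1 - p), Y1, mul_zero, zero_mul]
  have Y3 : (1 - p) * X * (p * (1 - q)) = 0 := by
    refine eq_zero_of_mixedMap_eq_smul (by simpa using d1.mul d3) hz
      (mixedMap_compress_eq_smul hp.one_sub r3 (hXr _) fun μ =>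
        mul_mul_eq_of_sandwich ?_ ?_)
    · rw [h.one_sub_p_mul, zero_mul, zero_mul]
    · have h1 : ∀ W : Matrix (Fin k) (Fin k) ℂ,
          W - p * (1 - q) * W = (1 - p) * W + p * q * W := by
        intro W
        noncomm_ring
      rw [h1, mul_assoc _ (1 - p) X, mul_assoc, mul_add, ← mul_assoc ((1 - p) * X),
        ← mul_assoc ((1 - p) * X), Y1, Y2, zero_mul, add_zero, mul_zero]
  calc (1 - p) * X = (1 - p) * X * ((1 - p) + p * q + p * (1 - q)) := by
        rw [add_compl, mul_one]
    _ = 0 := by rw [mul_add, mul_add, Y1, Y2, Y3, add_zero, add_zero]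

theorem mul_one_sub_p_eq_zero (h : TransferCondition p q v) (hp : IsStarProjection p)
    (hq : IsStarProjection q) {z : ℂ} (hz : 1 ≤ ‖z‖) {X : Matrix (Fin k) (Fin k) ℂ}
    (hX : transferMap v X * (1 - p) = z • (X * (1 - p))) : X * (1 - p) = 0 := by
  have hps : (1 - p)ᴴ = 1 - p := hp.one_sub.isSelfAdjoint
  have h1 := congrArg Matrix.conjTranspose hX
  rw [Matrix.conjTranspose_mul, Matrix.conjTranspose_smul, Matrix.conjTranspose_mul, hps,
    conjTranspose_transferMap] at h1
  have h2 := h.one_sub_p_mul_eq_zero hp hq (by rwa [norm_star]) h1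
  have h3 := congrArg Matrix.conjTranspose h2
  rwa [Matrix.conjTranspose_mul, hps, Matrix.conjTranspose_conjTranspose,
    Matrix.conjTranspose_zero] at h3

/-- The `(pq, pq)` block of the transfer map, on matrices supported in `p`. -/
theorem pq_mul_transferMap (h : TransferCondition p q v) (hp : IsStarProjection p)
    (hq : IsStarProjection q) {X : Matrix (Fin k) (Fin k) ℂ} (hl : (1 - p) * X = 0)
    (hr : X * (1 - p) = 0) :
    p * q * transferMap v X * (p * q) =
      transferMap (compress v (p * q)) (p * q * X * (p * q)) := by
  have r2 : IsStarProjection (p * q) := hp.mul hq h.commute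
  have hrr : p * q * (p * q) = p * q := r2.isIdempotentElem
  have hrs : (p * q)ᴴ = p * q := r2.isSelfAdjoint
  rw [transferMap_apply, transferMap_apply, Finset.mul_sum, Finset.sum_mul]
  refine Finset.sum_congr rfl fun μ _ => ?_
  have key : p * q * v μ * X * (p * q * v μ)ᴴ =
      p * q * v μ * (p * q * X * (p * q)) * (p * q * v μ)ᴴ := by
    refine mul_mul_eq_of_sandwich ?_ ?_
    · rw [h.pq_mul, mul_assoc _ (1 - p), hl, mul_zero, zero_mul]
    · have h1 := congrArg Matrix.conjTranspose (h.pq_mul μ)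
      rw [Matrix.conjTranspose_sub, Matrix.conjTranspose_mul _ (p * q),
        Matrix.conjTranspose_mul _ (1 - p), hrs,
        show (1 - p)ᴴ = 1 - p from hp.one_sub.isSelfAdjoint] at h1
      rw [h1, ← mul_assoc, mul_assoc _ X, hr, mul_zero, zero_mul]
  rw [Matrix.conjTranspose_mul (p * q), hrs] at key
  calc p * q * (v μ * X * (v μ)ᴴ) * (p * q) = p * q * v μ * X * ((v μ)ᴴ * (p * q)) := by
        simp only [mul_assoc]
    _ = _ := by
        rw [key, compress, Matrix.conjTranspose_mul (p * q * v μ) (p * q),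
          Matrix.conjTranspose_mul (p * q) (v μ), hrs]
        calc p * q * v μ * (p * q * X * (p * q)) * ((v μ)ᴴ * (p * q))
            = p * q * v μ * ((p * q) * (p * q) * X * ((p * q) * (p * q))) *
              ((v μ)ᴴ * (p * q)) := by rw [hrr]
          _ = _ := by simp only [mul_assoc]

/-- A peripheral eigenvector of the transfer map is determined by its `(pq, pq)` block. -/
theorem eq_zero_of_eigen (h : TransferCondition p q v) (hp : IsStarProjection p)
    (hq : IsStarProjection q) {z : ℂ} (hz : 1 ≤ ‖z‖) {X : Matrix (Fin k) (Fin k) ℂ}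
    (hX : transferMap v X = z • X) (hpqX : p * q * X * (p * q) = 0) : X = 0 := by
  obtain ⟨φ, e, -, -, hpq⟩ := h.tendsto_compress_pq
  have d3 := (h.tendsto_compress_compl hp hq).norm
  have d2 := (hpq 1).norm
  have r2 : IsStarProjection (p * q) := hp.mul hq h.commute
  have r3 := isStarProjection_mul_compl hp hq h.commute
  have hps : (1 - p)ᴴ = 1 - p := hp.one_sub.isSelfAdjoint
  have key : ∀ (z : ℂ) (X : Matrix (Fin k) (Fin k) ℂ), 1 ≤ ‖z‖ → transferMap v X = z • X →
      p * q * X * (p * q) = 0 → p * (1 - q) * X * (p * q) = 0 := by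
    intro z X hz hX hpqX
    have hl : (1 - p) * X = 0 := h.one_sub_p_mul_eq_zero hp hq hz (by rw [hX, Matrix.mul_smul])
    have hr : X * (1 - p) = 0 := h.mul_one_sub_p_eq_zero hp hq hz (by rw [hX, Matrix.smul_mul])
    refine eq_zero_of_mixedMap_eq_smul (by simpa using d3.mul d2) hz
      (mixedMap_compress_eq_smul r3 r2 (by rw [hX, Matrix.mul_smul, Matrix.smul_mul]) fun μ => ?_)
    have h1 := congrArg Matrix.conjTranspose (h.pq_mul μ)
    rw [Matrix.conjTranspose_sub, Matrix.conjTranspose_mul _ (p * q),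
      Matrix.conjTranspose_mul _ (1 - p), show (p * q)ᴴ = p * q from r2.isSelfAdjoint, hps] at h1
    have h2 : ∀ W : Matrix (Fin k) (Fin k) ℂ, X * (W - p * q * W) = X * ((1 - p) * W) →
        X * W = X * (p * q) * W := by
      intro W hW
      rw [← mul_assoc X (1 - p), hr, zero_mul, mul_sub, sub_eq_zero] at hW
      rw [hW]
      simp only [mul_assoc]
    have h3 := h2 (p * q * v μ)ᴴ (by rw [h1])
    have h4 : ∀ V : Matrix (Fin k) (Fin k) ℂ,
        V * (X * (p * q)) = V * (p * (1 - q) * X * (p * q)) := by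
      intro V
      have : V * (X * (p * q)) = V * ((1 - p) * X) * (p * q) + V * (p * q * X * (p * q)) +
          V * (p * (1 - q) * X * (p * q)) := by noncomm_ring
      rw [this, hl, hpqX, mul_zero, zero_mul, zero_add, zero_add]
    rw [mul_assoc _ X, h3, ← mul_assoc _ (X * (p * q)), h4]
  have hl : (1 - p) * X = 0 := h.one_sub_p_mul_eq_zero hp hq hz (by rw [hX, Matrix.mul_smul])
  have hr : X * (1 - p) = 0 := h.mul_one_sub_p_eq_zero hp hq hz (by rw [hX, Matrix.smul_mul])
  have Y32 := key z X hz hX hpqX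
  have Y23 : p * q * X * (p * (1 - q)) = 0 := by
    have h1 := congrArg Matrix.conjTranspose hpqX
    have h2 := congrArg Matrix.conjTranspose hX
    have hs2 : (p * q)ᴴ = p * q := r2.isSelfAdjoint
    have hs3 : (p * (1 - q))ᴴ = p * (1 - q) := r3.isSelfAdjoint
    rw [Matrix.conjTranspose_mul _ (p * q), Matrix.conjTranspose_mul _ X, hs2,
      Matrix.conjTranspose_zero, ← mul_assoc] at h1
    rw [conjTranspose_transferMap, Matrix.conjTranspose_smul] at h2
    have h3 := congrArg Matrix.conjTranspose (key (star z) Xᴴ (by rwa [norm_star]) h2 h1)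
    rwa [Matrix.conjTranspose_mul _ (p * q), Matrix.conjTranspose_mul _ Xᴴ, hs2, hs3,
      Matrix.conjTranspose_zero, Matrix.conjTranspose_conjTranspose, ← mul_assoc] at h3
  have hdec : X = p * (1 - q) * X * (p * (1 - q)) := by
    have h1 : X = (1 - p) * X + p * (X * (1 - p)) + p * q * X * (p * q) +
        p * q * X * (p * (1 - q)) + p * (1 - q) * X * (p * q) +
        p * (1 - q) * X * (p * (1 - q)) := by
      noncomm_ring
    rw [hl, hr, hpqX, Y23, Y32, mul_zero] at h1
    simpa only [zero_add] using h1
  have Y33 : p * (1 - q) * X * (p * (1 - q)) = 0 := by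
    refine eq_zero_of_mixedMap_eq_smul (by simpa using d3.mul d3) hz
      (mixedMap_compress_eq_smul r3 r3 (by rw [hX, Matrix.mul_smul, Matrix.smul_mul]) fun μ => ?_)
    rw [← hdec]
  rw [hdec, Y33]

/-- A peripheral eigenvalue of the transfer map is `1`, and the `(pq, pq)` block of its
eigenvector is a multiple of the limit matrix `e` of the compressed transfer map. -/
theorem pq_block_eigen (h : TransferCondition p q v) (hp : IsStarProjection p)
    (hq : IsStarProjection q) {φ : Matrix (Fin k) (Fin k) ℂ →ₗ[ℂ] ℂ}
    {e : Matrix (Fin k) (Fin k) ℂ}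
    (hpq : ∀ A, Tendsto
        (fun N : ℕ => (transferMap (compress v (p * q)) ^ N) A) atTop (𝓝 (φ A • e)))
    {z : ℂ} (hz : 1 ≤ ‖z‖) {X : Matrix (Fin k) (Fin k) ℂ} (hX : transferMap v X = z • X) :
    z • (p * q * X * (p * q)) = p * q * X * (p * q) ∧
      φ (p * q * X * (p * q)) • e = p * q * X * (p * q) := by
  have hl : (1 - p) * X = 0 := h.one_sub_p_mul_eq_zero hp hq hz (by rw [hX, Matrix.mul_smul])
  have hr : X * (1 - p) = 0 := h.mul_one_sub_p_eq_zero hp hq hz (by rw [hX, Matrix.smul_mul])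
  have h1 := h.pq_mul_transferMap hp hq hl hr
  rw [hX, Matrix.mul_smul, Matrix.smul_mul] at h1
  refine smul_eq_self_of_tendsto_pow_smul hz ((hpq (p * q * X * (p * q))).congr fun N => ?_)
  induction N with
  | zero => simp
  | succ N ih => rw [pow_succ', Module.End.mul_apply, ih, map_smul, ← h1, smul_smul, pow_succ]

end TransferCondition

end Spectrum

/-! ### Exponential convergence to a rank one map -/

section Convergence

variable {n k : ℕ} {p q : Matrix (Fin k) (Fin k) ℂ} {v : Fin n → Matrix (Fin k) (Fin k) ℂ}

namespace TransferCondition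

theorem nontrivial (h : TransferCondition p q v) : Nontrivial (Matrix (Fin k) (Fin k) ℂ) :=
  ⟨⟨_, _, h.mul_ne_zero⟩⟩

theorem pq_mul_transferMap_pow (h : TransferCondition p q v) (hp : IsStarProjection p)
    (hq : IsStarProjection q) (N : ℕ) :
    p * q * (transferMap v ^ N) (p * q) * (p * q) =
      (transferMap (compress v (p * q)) ^ N) (p * q) := by
  have r2 : IsStarProjection (p * q) := hp.mul hq h.commute
  have hrr : p * q * (p * q) = p * q := r2.isIdempotentElem
  have hps : pᴴ = p := hp.isSelfAdjoint
  have hcorner : ∀ X : Matrix (Fin k) (Fin k) ℂ, (1 - p) * X = 0 → X * (1 - p) = 0 →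
      (1 - p) * transferMap v X = 0 ∧ transferMap v X * (1 - p) = 0 := by
    intro X hl hr
    have hl' : X = p * X := by rwa [sub_mul, one_mul, sub_eq_zero] at hl
    have hr' : X = X * p := by rwa [mul_sub, mul_one, sub_eq_zero] at hr
    have h0 : (1 - p) * p = 0 := hp.one_sub_mul_self
    have h0' : p * (1 - p) = 0 := hp.mul_one_sub_self
    constructor
    · rw [transferMap_apply, Finset.mul_sum]
      refine Finset.sum_eq_zero fun μ _ => ?_
      rw [hl', ← mul_assoc (v μ), h.invariant_p]
      simp only [← mul_assoc, h0, zero_mul]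
    · rw [transferMap_apply, Finset.sum_mul]
      refine Finset.sum_eq_zero fun μ _ => ?_
      have h1 : p * (v μ)ᴴ = p * (v μ)ᴴ * p := by
        have := congrArg Matrix.conjTranspose (h.invariant_p μ)
        simpa only [Matrix.conjTranspose_mul, hps, mul_assoc] using this
      rw [hr', ← mul_assoc, mul_assoc _ p, h1]
      simp only [mul_assoc, h0', mul_zero]
  have hall : ∀ N : ℕ, (1 - p) * (transferMap v ^ N) (p * q) = 0 ∧
      (transferMap v ^ N) (p * q) * (1 - p) = 0 := by
    intro N
    induction N with
    | zero =>
      constructor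
      · rw [pow_zero, Module.End.one_apply, ← mul_assoc, hp.one_sub_mul_self, zero_mul]
      · rw [pow_zero, Module.End.one_apply, h.commute, mul_assoc, hp.mul_one_sub_self, mul_zero]
    | succ N ih =>
      rw [pow_succ', Module.End.mul_apply]
      exact hcorner _ ih.1 ih.2
  induction N with
  | zero => rw [pow_zero, pow_zero, Module.End.one_apply, hrr, hrr]
  | succ N ih =>
    rw [pow_succ', pow_succ', Module.End.mul_apply, Module.End.mul_apply,
      h.pq_mul_transferMap hp hq (hall N).1 (hall N).2, ih]

theorem exists_fixed (h : TransferCondition p q v) (hp : IsStarProjection p)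
    (hq : IsStarProjection q) : ∃ X, X ≠ 0 ∧ transferMap v X = X := by
  by_contra! hno
  obtain ⟨φ, e, hφ, he, hpq⟩ := h.tendsto_compress_pq
  have := h.nontrivial
  obtain ⟨C, s, hC, hs0, hs1, hb⟩ := exists_norm_pow_le (transferMap v) fun z A hz hA => by
    by_contra hne
    refine hne (h.eq_zero_of_eigen hp hq hz hA ?_)
    by_contra hB
    have h1 := (h.pq_block_eigen hp hq hpq hz hA).1
    have h2 : z = 1 := by
      have : (z - 1) • (p * q * A * (p * q)) = 0 := by rw [sub_smul, one_smul, h1, sub_self]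
      exact sub_eq_zero.1 ((smul_eq_zero.1 this).resolve_right hB)
    subst h2
    exact hno A hne (by rw [hA, one_smul])
  have h1 : Tendsto (fun N : ℕ => (transferMap v ^ N) (p * q)) atTop (𝓝 0) := by
    refine squeeze_zero_norm (fun N => hb N (p * q)) ?_
    simpa using ((tendsto_pow_atTop_nhds_zero_of_lt_one hs0.le hs1).const_mul C).mul_const ‖p * q‖
  have h2 := (h1.const_mul (p * q)).mul_const (p * q)
  simp only [h.pq_mul_transferMap_pow hp hq, mul_zero, zero_mul] at h2
  have h3 := tendsto_nhds_unique (hpq (p * q)) h2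
  exact (smul_ne_zero hφ he) h3

/-- The powers of the transfer map converge exponentially fast to a rank one map `f(·) e`. -/
theorem exists_rank_one_limit (h : TransferCondition p q v) (hp : IsStarProjection p)
    (hq : IsStarProjection q) :
    ∃ (f : Matrix (Fin k) (Fin k) ℂ →ₗ[ℂ] ℂ) (e : Matrix (Fin k) (Fin k) ℂ) (C s : ℝ),
      transferMap v e = e ∧ (∀ X, f (transferMap v X) = f X) ∧ 0 < C ∧ 0 < s ∧ s < 1 ∧
      ∀ (N : ℕ) (X : Matrix (Fin k) (Fin k) ℂ),
        ‖(transferMap v ^ N) X - f X • e‖ ≤ C * s ^ N * ‖X‖ := by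
  obtain ⟨φ, ε, hφ, hε, hpq⟩ := h.tendsto_compress_pq
  have := h.nontrivial
  obtain ⟨e, he0, he⟩ := h.exists_fixed hp hq
  have heig : transferMap v e = (1 : ℂ) • e := by rw [he, one_smul]
  have hone : (1 : ℝ) ≤ ‖(1 : ℂ)‖ := by simp
  have hl : (1 - p) * e = 0 := h.one_sub_p_mul_eq_zero hp hq hone (by rw [he, one_smul])
  have hr : e * (1 - p) = 0 := h.mul_one_sub_p_eq_zero hp hq hone (by rw [he, one_smul])
  have hB0 : p * q * e * (p * q) ≠ 0 := fun h0 => he0 (h.eq_zero_of_eigen hp hq hone heig h0)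
  have hBε := (h.pq_block_eigen hp hq hpq hone heig).2
  -- The eigenvalue `1` is simple, and there is no other peripheral eigenvalue.
  have hsimple : ∀ (z : ℂ) (X : Matrix (Fin k) (Fin k) ℂ), 1 ≤ ‖z‖ → transferMap v X = z • X →
      ∃ d : ℂ, X = d • e := by
    intro z X hz hX
    by_cases hX0 : p * q * X * (p * q) = 0
    · exact ⟨0, by rw [zero_smul, h.eq_zero_of_eigen hp hq hz hX hX0]⟩
    obtain ⟨h1, h2⟩ := h.pq_block_eigen hp hq hpq hz hX
    have hz1 : z = 1 := by
      have : (z - 1) • (p * q * X * (p * q)) = 0 := by rw [sub_smul, one_smul, h1, sub_self]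
      exact sub_eq_zero.1 ((smul_eq_zero.1 this).resolve_right hX0)
    subst hz1
    have hc : φ (p * q * e * (p * q)) ≠ 0 := by
      intro h0
      rw [h0, zero_smul] at hBε
      exact hB0 hBε.symm
    refine ⟨φ (p * q * X * (p * q)) / φ (p * q * e * (p * q)), ?_⟩
    rw [← sub_eq_zero]
    refine h.eq_zero_of_eigen hp hq hone (by rw [map_sub, map_smul, he, hX, one_smul, one_smul]) ?_
    rw [mul_sub, sub_mul, Matrix.mul_smul, Matrix.smul_mul, sub_eq_zero]
    calc p * q * X * (p * q) = φ (p * q * X * (p * q)) • ε := h2.symm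
      _ = (φ (p * q * X * (p * q)) / φ (p * q * e * (p * q))) • φ (p * q * e * (p * q)) • ε := by
        rw [smul_smul, div_mul_cancel₀ _ hc]
      _ = _ := by rw [hBε]
  -- The eigenvalue `1` has no Jordan block.
  have hrange : e ∉ LinearMap.range (transferMap v - 1) := by
    rintro ⟨X, hX⟩
    have hX' : transferMap v X = X + e := by
      rw [← hX, LinearMap.sub_apply, Module.End.one_apply, add_sub_cancel]
    have hlX : (1 - p) * X = 0 := h.one_sub_p_mul_eq_zero hp hq hone (by
      rw [hX', mul_add, hl, add_zero, one_smul])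
    have hrX : X * (1 - p) = 0 := h.mul_one_sub_p_eq_zero hp hq hone (by
      rw [hX', add_mul, hr, add_zero, one_smul])
    have hX2 := h.pq_mul_transferMap hp hq hlX hrX
    have he2 := h.pq_mul_transferMap hp hq hl hr
    rw [hX', mul_add, add_mul] at hX2
    rw [he] at he2
    have hpow : ∀ N : ℕ, (transferMap (compress v (p * q)) ^ N) (p * q * X * (p * q)) =
        p * q * X * (p * q) + (N : ℂ) • (p * q * e * (p * q)) := by
      intro N
      induction N with
      | zero => simp
      | succ N ih =>
        rw [pow_succ', Module.End.mul_apply, ih, map_add, map_smul, ← he2, ← hX2]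
        push_cast
        rw [add_smul, one_smul]
        abel
    have hlim := hpq (p * q * X * (p * q))
    have hdiff : Tendsto (fun N : ℕ =>
        (transferMap (compress v (p * q)) ^ (N + 1)) (p * q * X * (p * q)) -
          (transferMap (compress v (p * q)) ^ N) (p * q * X * (p * q))) atTop (𝓝 0) := by
      simpa using ((tendsto_add_atTop_iff_nat 1).2 hlim).sub hlim
    have hconst : ∀ N : ℕ, (transferMap (compress v (p * q)) ^ (N + 1)) (p * q * X * (p * q)) -
          (transferMap (compress v (p * q)) ^ N) (p * q * X * (p * q)) = p * q * e * (p * q) := by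
      intro N
      rw [hpow, hpow]
      push_cast
      rw [add_smul, one_smul]
      abel
    simp only [hconst] at hdiff
    exact hB0 (tendsto_nhds_unique tendsto_const_nhds hdiff)
  obtain ⟨f₀, hf₀, hker⟩ := Submodule.exists_le_ker_of_notMem hrange
  set f : Matrix (Fin k) (Fin k) ℂ →ₗ[ℂ] ℂ := (f₀ e)⁻¹ • f₀ with hf
  have hfe : f e = 1 := by
    rw [hf, LinearMap.smul_apply, smul_eq_mul, inv_mul_cancel₀ hf₀]
  have hfT : ∀ X, f (transferMap v X) = f X := by
    intro X
    have h1 : f₀ (transferMap v X - X) = 0 := hker ⟨X, rfl⟩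
    rw [map_sub, sub_eq_zero] at h1
    rw [hf, LinearMap.smul_apply, LinearMap.smul_apply, h1]
  set S : Module.End ℂ (Matrix (Fin k) (Fin k) ℂ) := transferMap v - f.smulRight e with hS
  have hSX : ∀ X, S X = transferMap v X - f X • e := fun X => rfl
  obtain ⟨C, s, hC, hs0, hs1, hb⟩ := exists_norm_pow_le S fun z A hz hA => by
    have hz0 : z ≠ 0 := by
      rintro rfl
      simp at hz
      linarith
    have h1 : f A = 0 := by
      have h2 := congrArg f hA
      rw [hSX, map_sub, map_smul, hfT, hfe, map_smul, smul_eq_mul, smul_eq_mul, mul_one,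
        sub_self] at h2
      exact (mul_eq_zero.1 h2.symm).resolve_left hz0
    rw [hSX, h1, zero_smul, sub_zero] at hA
    obtain ⟨d, rfl⟩ := hsimple z A hz hA
    rw [map_smul, hfe, smul_eq_mul, mul_one] at h1
    rw [h1, zero_smul]
  have hpowS : ∀ (N : ℕ) (Y : Matrix (Fin k) (Fin k) ℂ), f Y = 0 →
      (S ^ N) Y = (transferMap v ^ N) Y ∧ f ((transferMap v ^ N) Y) = 0 := by
    intro N Y hY
    induction N with
    | zero => simpa using hY
    | succ N ih =>
      rw [pow_succ', pow_succ', Module.End.mul_apply, Module.End.mul_apply, ih.1, hSX, ih.2,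
        zero_smul, sub_zero, hfT]
      exact ⟨rfl, ih.2⟩
  have hTe : ∀ N : ℕ, (transferMap v ^ N) e = e := by
    intro N
    induction N with
    | zero => simp
    | succ N ih => rw [pow_succ', Module.End.mul_apply, ih, he]
  set K := ‖LinearMap.toContinuousLinearMap f‖ with hK
  have hK0 : 0 ≤ K := norm_nonneg _
  refine ⟨f, e, C * (1 + K * ‖e‖), s, he, hfT, by positivity, hs0, hs1, fun N X => ?_⟩
  have h1 : f (X - f X • e) = 0 := by
    rw [map_sub, map_smul, hfe, smul_eq_mul, mul_one, sub_self]
  have h2 : (transferMap v ^ N) X - f X • e = (S ^ N) (X - f X • e) := by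
    rw [(hpowS N _ h1).1, map_sub, map_smul, hTe]
  have h3 : ‖X - f X • e‖ ≤ (1 + K * ‖e‖) * ‖X‖ := by
    have h4 : ‖f X‖ ≤ K * ‖X‖ := (LinearMap.toContinuousLinearMap f).le_opNorm X
    calc ‖X - f X • e‖ ≤ ‖X‖ + ‖f X‖ * ‖e‖ := (norm_sub_le _ _).trans (by rw [norm_smul])
      _ ≤ ‖X‖ + K * ‖X‖ * ‖e‖ := by gcongr
      _ = _ := by ring
  rw [h2]
  calc _ ≤ C * s ^ N * ‖X - f X • e‖ := hb N _
    _ ≤ C * s ^ N * ((1 + K * ‖e‖) * ‖X‖) := by gcongr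
    _ = _ := by ring

end TransferCondition

end Convergence

/-! ### Positivity and supports of the limit -/

section Support

variable {n k : ℕ} {p q : Matrix (Fin k) (Fin k) ℂ} {v : Fin n → Matrix (Fin k) (Fin k) ℂ}

/-- Over the complex numbers, nonnegativity of the quadratic form entails hermiticity. -/
theorem posSemidef_of_dotProduct_nonneg {M : Matrix (Fin k) (Fin k) ℂ}
    (hM : ∀ x, 0 ≤ star x ⬝ᵥ M *ᵥ x) : M.PosSemidef := by
  rw [← Matrix.isPositive_toEuclideanLin_iff, LinearMap.isPositive_iff_complex]
  intro x
  have h := hM x.ofLp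
  have h1 : inner ℂ (Matrix.toEuclideanLin M x) x = star (star x.ofLp ⬝ᵥ M *ᵥ x.ofLp) := by
    rw [EuclideanSpace.inner_eq_star_dotProduct, Matrix.star_dotProduct, star_star,
      dotProduct_comm]
    rfl
  rw [Complex.nonneg_iff] at h
  rw [h1]
  refine ⟨?_, ?_⟩
  · apply Complex.ext
    · simp
    · simp [← h.2]
  · simpa using h.1

theorem posSemidef_of_tendsto {A : ℕ → Matrix (Fin k) (Fin k) ℂ} {L : Matrix (Fin k) (Fin k) ℂ}
    (hA : ∀ N, (A N).PosSemidef) (h : Tendsto A atTop (𝓝 L)) : L.PosSemidef := by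
  refine posSemidef_of_dotProduct_nonneg fun x => ?_
  have hlin : Continuous fun M : Matrix (Fin k) (Fin k) ℂ => star x ⬝ᵥ M *ᵥ x := by
    let g : Matrix (Fin k) (Fin k) ℂ →ₗ[ℂ] ℂ :=
      { toFun := fun M => star x ⬝ᵥ M *ᵥ x
        map_add' := fun M M' => by rw [Matrix.add_mulVec, dotProduct_add]
        map_smul' := fun c M => by rw [Matrix.smul_mulVec, dotProduct_smul]; rfl }
    exact g.continuous_of_finiteDimensional
  exact ge_of_tendsto' ((hlin.tendsto L).comp h) fun N => (hA N).dotProduct_mulVec_nonneg x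

theorem posSemidef_transferMap_pow {X : Matrix (Fin k) (Fin k) ℂ} (hX : X.PosSemidef) (N : ℕ) :
    ((transferMap v ^ N) X).PosSemidef := by
  rw [transferMap_pow_apply]
  exact Matrix.posSemidef_sum _ fun u _ => hX.mul_mul_conjTranspose_same _

theorem posSemidef_of_isStarProjection {r : Matrix (Fin k) (Fin k) ℂ} (hr : IsStarProjection r) :
    r.PosSemidef := by
  have h := Matrix.posSemidef_self_mul_conjTranspose r
  rwa [show rᴴ = r from hr.isSelfAdjoint, hr.isIdempotentElem.eq] at h

/-- The kernel of a positive fixed point of a completely positive map is invariant under the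
adjoints of the Kraus operators. -/
theorem mulVec_conjTranspose_eq_zero {ι : Type*} [Fintype ι]
    {m : ι → Matrix (Fin k) (Fin k) ℂ} {h : Matrix (Fin k) (Fin k) ℂ} (hh : h.PosSemidef)
    (hm : ∑ i, m i * h * (m i)ᴴ = h) {ξ : Fin k → ℂ} (hξ : h *ᵥ ξ = 0) (i : ι) :
    h *ᵥ ((m i)ᴴ *ᵥ ξ) = 0 := by
  have hterm : ∀ i, star ξ ⬝ᵥ (m i * h * (m i)ᴴ) *ᵥ ξ =
      star ((m i)ᴴ *ᵥ ξ) ⬝ᵥ h *ᵥ ((m i)ᴴ *ᵥ ξ) := by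
    intro i
    rw [Matrix.star_mulVec, Matrix.conjTranspose_conjTranspose, ← Matrix.dotProduct_mulVec,
      Matrix.mulVec_mulVec, Matrix.mulVec_mulVec, mul_assoc]
  have hsum : ∑ i, star ((m i)ᴴ *ᵥ ξ) ⬝ᵥ h *ᵥ ((m i)ᴴ *ᵥ ξ) = 0 := by
    simp only [← hterm]
    rw [← dotProduct_sum, ← Matrix.sum_mulVec, hm, hξ, dotProduct_zero]
  have h1 := (Finset.sum_eq_zero_iff_of_nonneg fun i _ =>
    hh.dotProduct_mulVec_nonneg ((m i)ᴴ *ᵥ ξ)).1 hsum i (Finset.mem_univ i)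
  exact (hh.dotProduct_mulVec_zero_iff _).1 h1

/-- If a vector in the range of `h` is cyclic for operators whose adjoints leave the kernel of
`h` invariant, then the kernel of `h` is as small as possible. -/
theorem mulVec_eq_zero_of_cyclic {h r : Matrix (Fin k) (Fin k) ℂ} (hh : h.PosSemidef)
    (hhr : h * r = h) {S : Set (Matrix (Fin k) (Fin k) ℂ)}
    (hS : ∀ Y ∈ S, ∀ ξ, h *ᵥ ξ = 0 → h *ᵥ (Yᴴ *ᵥ ξ) = 0) {ζ : Fin k → ℂ}
    (hcyc : ∀ ξ, ∃ Y ∈ S, Y *ᵥ (h *ᵥ ζ) = r *ᵥ ξ) {ξ : Fin k → ℂ} (hξ : h *ᵥ ξ = 0) :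
    r *ᵥ ξ = 0 := by
  obtain ⟨Y, hY, hYξ⟩ := hcyc ξ
  have h1 : h *ᵥ (r *ᵥ ξ) = 0 := by rw [Matrix.mulVec_mulVec, hhr, hξ]
  have h2 := hS Y hY _ h1
  have h3 : star (r *ᵥ ξ) ⬝ᵥ (r *ᵥ ξ) = star (h *ᵥ (Yᴴ *ᵥ (r *ᵥ ξ))) ⬝ᵥ ζ := by
    rw [Matrix.star_mulVec h, Matrix.star_mulVec Yᴴ, Matrix.conjTranspose_conjTranspose,
      hh.isHermitian.eq, ← Matrix.dotProduct_mulVec, ← Matrix.dotProduct_mulVec, hYξ]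
  rw [h2, star_zero, zero_dotProduct] at h3
  exact dotProduct_star_self_eq_zero.1 h3

theorem exists_partial_inverse {h r : Matrix (Fin k) (Fin k) ℂ} (hr : IsStarProjection r)
    (hrh : r * h = h) (hhr : h * r = h) (hker : ∀ ξ, h *ᵥ ξ = 0 → r *ᵥ ξ = 0) :
    ∃ h', h' * h = r ∧ h * h' = r := by
  have hrr : r * r = r := hr.isIdempotentElem
  have hdet : IsUnit (h + (1 - r)).det := by
    rw [isUnit_iff_ne_zero, Ne, ← Matrix.exists_mulVec_eq_zero_iff]
    rintro ⟨ξ, hξ0, hξ⟩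
    have h1 : h *ᵥ ξ = 0 := by
      have h2 : r * (h + (1 - r)) = h := by rw [mul_add, hrh, mul_sub, mul_one, hrr, sub_self,
        add_zero]
      have h3 := congrArg (r *ᵥ ·) hξ
      simpa only [Matrix.mulVec_mulVec, h2, Matrix.mulVec_zero] using h3
    have h2 := hker ξ h1
    rw [Matrix.add_mulVec, h1, zero_add, Matrix.sub_mulVec, Matrix.one_mulVec, h2, sub_zero] at hξ
    exact hξ0 hξ
  have h1 : (h + (1 - r)) * r = h := by
    rw [add_mul, hhr, sub_mul, one_mul, hrr, sub_self, add_zero]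
  have h2 : r * (h + (1 - r)) = h := by
    rw [mul_add, hrh, mul_sub, mul_one, hrr, sub_self, add_zero]
  refine ⟨r * (h + (1 - r))⁻¹ * r, ?_, ?_⟩
  · rw [mul_assoc, hrh]
    nth_rewrite 2 [← h1]
    rw [mul_assoc, Matrix.nonsing_inv_mul_cancel_left _ _ hdet, hrr]
  · rw [← mul_assoc, ← mul_assoc, hhr]
    nth_rewrite 1 [← h2]
    rw [mul_assoc r, Matrix.mul_nonsing_inv _ hdet, mul_one, hrr]

theorem exists_mulVec_ne_zero {A B : Matrix (Fin k) (Fin k) ℂ} (h : A * B ≠ 0) :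
    ∃ ζ, A *ᵥ (B *ᵥ ζ) ≠ 0 := by
  by_contra! h0
  refine h ?_
  ext i j
  have := congrFun (h0 (Pi.single j 1)) i
  rw [Matrix.mulVec_mulVec] at this
  simpa using this

theorem exists_trace_eq (f : Matrix (Fin k) (Fin k) ℂ →ₗ[ℂ] ℂ) :
    ∃ ρ : Matrix (Fin k) (Fin k) ℂ, ∀ X, f X = (ρ * X).trace := by
  refine ⟨Matrix.of fun i j => f (Matrix.single j i 1), fun X => ?_⟩
  conv_lhs => rw [Matrix.matrix_eq_sum_single X]
  simp only [map_sum, Matrix.trace, Matrix.diag, Matrix.mul_apply, Matrix.of_apply]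
  rw [Finset.sum_comm]
  refine Finset.sum_congr rfl fun j _ => Finset.sum_congr rfl fun i _ => ?_
  have : Matrix.single i j (X i j) = X i j • Matrix.single i j (1 : ℂ) := by simp
  rw [this, map_smul, smul_eq_mul, mul_comm]

namespace TransferCondition

/-- The powers of the transfer map converge exponentially fast to `X ↦ Tr(ρ X) e`, where `e` is
invertible on the range of `p` and `ρ` is invertible on the range of `q`. -/
theorem exists_asymptotics (h : TransferCondition p q v) (hp : IsStarProjection p)
    (hq : IsStarProjection q) :
    ∃ (ρ e ρ' e' : Matrix (Fin k) (Fin k) ℂ) (C s : ℝ), e' * e = p ∧ e * e' = p ∧ ρ' * ρ = q ∧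
      0 < C ∧ 0 < s ∧ s < 1 ∧ ∀ (N : ℕ) (X : Matrix (Fin k) (Fin k) ℂ),
        ‖(transferMap v ^ N) X - (ρ * X).trace • e‖ ≤ C * s ^ N * ‖X‖ := by
  obtain ⟨f₀, e₀, C, s, he₀, hf₀, hC, hs0, hs1, hb⟩ := h.exists_rank_one_limit hp hq
  obtain ⟨φ, ε, hφ, hε, hpq⟩ := h.tendsto_compress_pq
  have r2 : IsStarProjection (p * q) := hp.mul hq h.commute
  have hps : pᴴ = p := hp.isSelfAdjoint
  have hqs : qᴴ = q := hq.isSelfAdjoint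
  have hlim : ∀ X, Tendsto (fun N : ℕ => (transferMap v ^ N) X) atTop (𝓝 (f₀ X • e₀)) := by
    intro X
    rw [tendsto_iff_norm_sub_tendsto_zero]
    refine squeeze_zero (fun N => norm_nonneg _) (fun N => hb N X) ?_
    simpa using ((tendsto_pow_atTop_nhds_zero_of_lt_one hs0.le hs1).const_mul C).mul_const ‖X‖
  -- Normalize so that `e` is the limit of the orbit of `p * q`.
  obtain ⟨e, he⟩ : ∃ e, e = f₀ (p * q) • e₀ := ⟨_, rfl⟩
  have hblock : p * q * e * (p * q) ≠ 0 := by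
    have h1 := ((hlim (p * q)).const_mul (p * q)).mul_const (p * q)
    simp only [h.pq_mul_transferMap_pow hp hq] at h1
    rw [he, tendsto_nhds_unique h1 (hpq (p * q))]
    exact smul_ne_zero hφ hε
  have hf0 : f₀ (p * q) ≠ 0 := by
    intro h0
    rw [he, h0, zero_smul, mul_zero, zero_mul] at hblock
    exact hblock rfl
  have he0 : e ≠ 0 := by
    intro h0
    rw [h0, mul_zero, zero_mul] at hblock
    exact hblock rfl
  have hTe : transferMap v e = e := by rw [he, map_smul, he₀]
  have hone : (1 : ℝ) ≤ ‖(1 : ℂ)‖ := by simp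
  have hpe : p * e = e := by
    have := h.one_sub_p_mul_eq_zero hp hq hone (X := e) (by rw [hTe, one_smul])
    rw [sub_mul, one_mul, sub_eq_zero] at this
    exact this.symm
  have hep : e * p = e := by
    have := h.mul_one_sub_p_eq_zero hp hq hone (X := e) (by rw [hTe, one_smul])
    rw [mul_sub, mul_one, sub_eq_zero] at this
    exact this.symm
  obtain ⟨f, hf⟩ : ∃ f : Matrix (Fin k) (Fin k) ℂ →ₗ[ℂ] ℂ, f = (f₀ (p * q))⁻¹ • f₀ := ⟨_, rfl⟩
  have hfe : ∀ X, f X • e = f₀ X • e₀ := by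
    intro X
    rw [hf, he, LinearMap.smul_apply, smul_smul, smul_eq_mul, mul_right_comm,
      inv_mul_cancel₀ hf0, one_mul]
  have hfT : ∀ X, f (transferMap v X) = f X := by
    intro X
    rw [hf, LinearMap.smul_apply, LinearMap.smul_apply, hf₀]
  have hlim' : ∀ X, Tendsto (fun N : ℕ => (transferMap v ^ N) X) atTop (𝓝 (f X • e)) := by
    intro X
    rw [hfe]
    exact hlim X
  have hePSD : e.PosSemidef := by
    rw [he]
    exact posSemidef_of_tendsto
      (fun N => posSemidef_transferMap_pow (posSemidef_of_isStarProjection r2) N) (hlim (p * q))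
  have hfpos : ∀ X : Matrix (Fin k) (Fin k) ℂ, X.PosSemidef → 0 ≤ f X := by
    intro X hX
    have h1 := (posSemidef_of_tendsto (fun N => posSemidef_transferMap_pow hX N)
      (hlim' X)).trace_nonneg
    rw [Matrix.trace_smul, smul_eq_mul] at h1
    have h2 : 0 < e.trace :=
      lt_of_le_of_ne hePSD.trace_nonneg fun h0 => he0 (hePSD.trace_eq_zero_iff.1 h0.symm)
    have h3 := mul_nonneg h1 (RCLike.inv_pos_of_pos h2).le
    rwa [mul_assoc, mul_inv_cancel₀ h2.ne', mul_one] at h3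
  obtain ⟨ρ, hρ⟩ := exists_trace_eq f
  have hρPSD : ρ.PosSemidef := by
    refine posSemidef_of_dotProduct_nonneg fun x => ?_
    have h1 := hfpos _ (Matrix.posSemidef_vecMulVec_self_star x)
    rwa [hρ, Matrix.mul_vecMulVec, Matrix.trace_vecMulVec, dotProduct_comm] at h1
  -- The functional does not see the range of `1 - q`.
  have hfq : f (1 - q) = 0 := by
    have h1 := hlim' (1 - q)
    have h2 := h.decay_q.tendsto (1 - q)
    simp only [transferMap_compress_pow_apply hq.one_sub h.mul_one_sub_q] at h2
    exact (smul_eq_zero.1 (tendsto_nhds_unique h1 h2)).resolve_right he0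
  have hρq' : ρ * (1 - q) = 0 := by
    have hcc : (1 - q) * (1 - q) = 1 - q := hq.one_sub.isIdempotentElem
    have hcs : (1 - q)ᴴ = 1 - q := hq.one_sub.isSelfAdjoint
    have h1 : ((1 - q)ᴴ * ρ * (1 - q)).PosSemidef := hρPSD.conjTranspose_mul_mul_same _
    have h2 : (1 - q)ᴴ * ρ * (1 - q) = 0 := by
      rw [← h1.trace_eq_zero_iff, hcs, Matrix.trace_mul_comm, ← mul_assoc, hcc,
        Matrix.trace_mul_comm, ← hρ, hfq]
    ext i j
    have h3 : ρ *ᵥ ((1 - q) *ᵥ Pi.single j 1) = 0 := by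
      rw [← hρPSD.dotProduct_mulVec_zero_iff, Matrix.star_mulVec, ← Matrix.dotProduct_mulVec,
        Matrix.mulVec_mulVec, Matrix.mulVec_mulVec, h2, Matrix.zero_mulVec,
        dotProduct_zero]
    have h4 := congrFun h3 i
    rw [Matrix.mulVec_mulVec] at h4
    simpa using h4
  have hρq : ρ * q = ρ := by
    rw [mul_sub, mul_one, sub_eq_zero] at hρq'
    exact hρq'.symm
  have hqρ : q * ρ = ρ := by
    have := congrArg Matrix.conjTranspose hρq
    rwa [Matrix.conjTranspose_mul, hqs, hρPSD.isHermitian.eq] at this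
  -- The kernel of `e`.
  have hkere : ∀ ξ, e *ᵥ ξ = 0 → p *ᵥ ξ = 0 := by
    have hfix : ∀ l : ℕ, (transferMap (compress v p) ^ l) e = e := by
      intro l
      induction l with
      | zero => simp
      | succ l ih =>
        rw [pow_succ', Module.End.mul_apply, ih]
        have h1 : transferMap (compress v p) e = p * transferMap v (p * e * p) * p := by
          rw [transferMap_apply, transferMap_apply, Finset.mul_sum, Finset.sum_mul]
          refine Finset.sum_congr rfl fun μ _ => ?_
          simp only [compress, Matrix.conjTranspose_mul, hps, mul_assoc]
        rw [h1, hpe, hep, hTe, hpe, hep]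
    obtain ⟨ζ, hζ⟩ := exists_mulVec_ne_zero (A := p * q) (B := e) fun h0 => hblock (by
      rw [h0, zero_mul])
    obtain ⟨l, -, hl⟩ := h.cyclic_p (e *ᵥ ζ)
      ⟨e *ᵥ ζ, by simp only [Matrix.mulVec_mulVec, hpe]⟩ hζ
    intro ξ hξ
    refine mulVec_eq_zero_of_cyclic hePSD hep (S := (monomialSpan (compress v p) l : Set _))
      (fun Y hY ξ hξ => ?_) (ζ := ζ) (fun ξ => ?_) hξ
    · refine Submodule.span_induction (p := fun Y _ => e *ᵥ (Yᴴ *ᵥ ξ) = 0) ?_ (by simp) ?_ ?_ hY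
      · rintro _ ⟨u, rfl⟩
        exact mulVec_conjTranspose_eq_zero hePSD
          ((transferMap_pow_apply (compress v p) l e).symm.trans (hfix l)) hξ u
      · intro Y Z _ _ h1 h2
        rw [Matrix.conjTranspose_add, Matrix.add_mulVec, Matrix.mulVec_add, h1, h2, add_zero]
      · intro c Y _ h1
        rw [Matrix.conjTranspose_smul, Matrix.smul_mulVec, Matrix.mulVec_smul, h1, smul_zero]
    · have h1 : p *ᵥ ξ ∈ Set.range (p *ᵥ ·) := ⟨ξ, rfl⟩
      rw [← hl] at h1
      exact h1
  -- The kernel of `ρ`.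
  have hkerρ : ∀ ξ, ρ *ᵥ ξ = 0 → q *ᵥ ξ = 0 := by
    have hfix : ∀ (l : ℕ) X, (ρ * (transferMap (compress v q) ^ l) X).trace = (ρ * X).trace := by
      intro l
      induction l with
      | zero => simp
      | succ l ih =>
        intro X
        rw [pow_succ, Module.End.mul_apply, ih]
        have h1 : transferMap (compress v q) X = q * transferMap v (q * X * q) * q := by
          rw [transferMap_apply, transferMap_apply, Finset.mul_sum, Finset.sum_mul]
          refine Finset.sum_congr rfl fun μ _ => ?_
          simp only [compress, Matrix.conjTranspose_mul, hqs, mul_assoc]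
        have h2 : ∀ Y, (ρ * (q * Y * q)).trace = (ρ * Y).trace := by
          intro Y
          rw [← mul_assoc, Matrix.trace_mul_comm, ← mul_assoc, ← mul_assoc, hqρ, hρq]
        rw [h1, h2, ← hρ, hfT, hρ, h2]
    have hfix' : ∀ l : ℕ, ∑ u : Fin l → Fin n,
        (monomial (compress v q) u)ᴴ * ρ * ((monomial (compress v q) u)ᴴ)ᴴ = ρ := by
      intro l
      rw [Matrix.ext_iff_trace_mul_right]
      intro X
      rw [← hfix l X, transferMap_pow_apply, Finset.sum_mul, Finset.mul_sum, Matrix.trace_sum,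
        Matrix.trace_sum]
      refine Finset.sum_congr rfl fun u _ => ?_
      rw [Matrix.conjTranspose_conjTranspose, mul_assoc, mul_assoc, Matrix.trace_mul_comm]
      simp only [mul_assoc]
    obtain ⟨ζ, hζ⟩ := exists_mulVec_ne_zero (A := p * q) (B := ρ) fun h0 => by
      have h1 : f (p * q) = 0 := by
        rw [hρ, Matrix.trace_mul_comm, h0, Matrix.trace_zero]
      rw [hf, LinearMap.smul_apply, smul_eq_mul, inv_mul_cancel₀ hf0] at h1
      exact one_ne_zero h1
    obtain ⟨l, -, hl⟩ := h.cyclic_q (ρ *ᵥ ζ)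
      ⟨ρ *ᵥ ζ, by simp only [Matrix.mulVec_mulVec, hqρ]⟩ hζ
    intro ξ hξ
    refine mulVec_eq_zero_of_cyclic hρPSD hρq
      (S := {Y | Yᴴ ∈ monomialSpan (compress v q) l})
      (fun Y hY ξ hξ => ?_) (ζ := ζ) (fun ξ => ?_) hξ
    · refine Submodule.span_induction (p := fun Y _ => ρ *ᵥ (Y *ᵥ ξ) = 0) ?_ (by simp) ?_ ?_ hY
      · rintro _ ⟨u, rfl⟩
        have := mulVec_conjTranspose_eq_zero hρPSD (hfix' l) hξ u
        rwa [Matrix.conjTranspose_conjTranspose] at this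
      · intro Y Z _ _ h1 h2
        rw [Matrix.add_mulVec, Matrix.mulVec_add, h1, h2, add_zero]
      · intro c Y _ h1
        rw [Matrix.smul_mulVec, Matrix.mulVec_smul, h1, smul_zero]
    · have h1 : q *ᵥ ξ ∈ Set.range (q *ᵥ ·) := ⟨ξ, rfl⟩
      rw [← hl] at h1
      obtain ⟨X, hX, hXξ⟩ := h1
      exact ⟨Xᴴ, by simpa using hX, hXξ⟩
  obtain ⟨e', he', he''⟩ := exists_partial_inverse hp hpe hep hkere
  obtain ⟨ρ', hρ', -⟩ := exists_partial_inverse hq hqρ hρq hkerρ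
  refine ⟨ρ, e, ρ', e', C, s, he', he'', hρ', hC, hs0, hs1, fun N X => ?_⟩
  rw [← hρ, hfe]
  exact hb N X

end TransferCondition

end Support

/-! ### Gram matrices of matrix product vectors -/

section Gram

variable {n k : ℕ} {p q : Matrix (Fin k) (Fin k) ℂ} {v : Fin n → Matrix (Fin k) (Fin k) ℂ}

theorem gammaMap_apply (l : ℕ) (X : Matrix (Fin k) (Fin k) ℂ) (u : Fin l → Fin n) :
    gammaMap v l X u = (X * (monomial v u)ᴴ).trace := rfl

/-- The Gram form of the maps `Γ_{N,v}` in terms of the powers of the transfer map. -/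
theorem inner_gammaMap (N : ℕ) (X Y : Matrix (Fin k) (Fin k) ℂ) :
    inner ℂ (gammaMap v N X) (gammaMap v N Y) =
      ∑ i, ∑ j, (Xᴴ * (transferMap v ^ N) (Matrix.single i j 1) * Y) i j := by
  have hterm : ∀ (m : Matrix (Fin k) (Fin k) ℂ) (i j : Fin k),
      (Xᴴ * (m * Matrix.single i j (1 : ℂ) * mᴴ) * Y) i j = (Xᴴ * m) i i * (mᴴ * Y) j j := by
    intro m i j
    have h1 : Xᴴ * (m * Matrix.single i j 1 * mᴴ) * Y =
        (Xᴴ * m) * Matrix.single i j 1 * (mᴴ * Y) := by simp only [mul_assoc]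
    rw [h1, Matrix.mul_apply, Finset.sum_eq_single j]
    · simp
    · intro l _ hl
      rw [Matrix.mul_single_apply_of_ne _ _ _ _ _ hl, zero_mul]
    · simp
  simp only [transferMap_pow_apply, Finset.mul_sum, Finset.sum_mul, Matrix.sum_apply, hterm]
  rw [PiLp.inner_apply]
  have h2 : ∀ i, ∑ j, ∑ u : Fin N → Fin n,
      (Xᴴ * monomial v u) i i * ((monomial v u)ᴴ * Y) j j =
      ∑ u : Fin N → Fin n, (Xᴴ * monomial v u) i i * ((monomial v u)ᴴ * Y).trace := by
    intro i
    rw [Finset.sum_comm]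
    simp only [← Finset.mul_sum]
    rfl
  simp only [h2]
  rw [Finset.sum_comm]
  refine Finset.sum_congr rfl fun u _ => ?_
  rw [← Finset.sum_mul]
  change _ = (Xᴴ * monomial v u).trace * _
  have h3 : (Xᴴ * monomial v u).trace = star (X * (monomial v u)ᴴ).trace := by
    rw [← Matrix.trace_conjTranspose, Matrix.conjTranspose_mul, Matrix.conjTranspose_conjTranspose,
      Matrix.trace_mul_comm]
  rw [h3, gammaMap_apply, gammaMap_apply, Matrix.trace_mul_comm _ Y]
  exact mul_comm _ _

theorem norm_trace_mul_le (ρ e X Y : Matrix (Fin k) (Fin k) ℂ) :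
    ‖(ρ * Xᴴ * e * Y).trace‖ ≤ k * ‖ρ‖ * ‖e‖ * ‖X‖ * ‖Y‖ := by
  refine (norm_trace_le _).trans ?_
  have h1 : ‖ρ * Xᴴ * e * Y‖ ≤ ‖ρ‖ * ‖X‖ * ‖e‖ * ‖Y‖ := by
    refine (norm_mul_le _ _).trans ?_
    gcongr
    refine (norm_mul_le _ _).trans ?_
    gcongr
    refine (norm_mul_le _ _).trans ?_
    rw [Matrix.l2_opNorm_conjTranspose]
  calc k * ‖ρ * Xᴴ * e * Y‖ ≤ k * (‖ρ‖ * ‖X‖ * ‖e‖ * ‖Y‖) := by gcongr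
    _ = _ := by ring

namespace TransferCondition

theorem exists_gram (h : TransferCondition p q v) (hp : IsStarProjection p)
    (hq : IsStarProjection q) :
    ∃ (ρ e ρ' e' : Matrix (Fin k) (Fin k) ℂ) (C s : ℝ), e' * e = p ∧ e * e' = p ∧ ρ' * ρ = q ∧
      0 < C ∧ 0 < s ∧ s < 1 ∧ ∀ (N : ℕ) (X Y : Matrix (Fin k) (Fin k) ℂ),
        ‖inner ℂ (gammaMap v N X) (gammaMap v N Y) - (ρ * Xᴴ * e * Y).trace‖ ≤
          C * s ^ N * ‖X‖ * ‖Y‖ := by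
  obtain ⟨ρ, e, ρ', e', C, s, h1, h2, h3, hC, hs0, hs1, hb⟩ := h.exists_asymptotics hp hq
  set κ : ℝ := ∑ i : Fin k, ∑ j : Fin k, ‖(Matrix.single i j 1 : Matrix (Fin k) (Fin k) ℂ)‖ with hκ
  have hκ0 : 0 ≤ κ := Finset.sum_nonneg fun i _ => Finset.sum_nonneg fun j _ => norm_nonneg _
  refine ⟨ρ, e, ρ', e', C * (κ + 1), s, h1, h2, h3, mul_pos hC (by linarith), hs0, hs1,
    fun N X Y => ?_⟩
  have hlim : (ρ * Xᴴ * e * Y).trace =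
      ∑ i, ∑ j, (Xᴴ * ((ρ * Matrix.single i j 1).trace • e) * Y) i j := by
    simp only [Matrix.trace_mul_single, MulOpposite.op_one, one_smul, Matrix.mul_smul,
      Matrix.smul_mul, Matrix.smul_apply, smul_eq_mul]
    rw [Finset.sum_comm, mul_assoc, mul_assoc, ← mul_assoc Xᴴ]
    rfl
  rw [inner_gammaMap, hlim, ← Finset.sum_sub_distrib]
  simp only [← Finset.sum_sub_distrib, ← Matrix.sub_apply, ← Matrix.sub_mul, ← Matrix.mul_sub]
  calc _ ≤ ∑ i, ∑ j, C * s ^ N * ‖(Matrix.single i j 1 : Matrix (Fin k) (Fin k) ℂ)‖ *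
        ‖X‖ * ‖Y‖ := by
        refine (norm_sum_le _ _).trans (Finset.sum_le_sum fun i _ => ?_)
        refine (norm_sum_le _ _).trans (Finset.sum_le_sum fun j _ => ?_)
        refine (norm_entry_le _ _ _).trans ((norm_mul_le _ _).trans ?_)
        gcongr
        refine (norm_mul_le _ _).trans ?_
        rw [Matrix.l2_opNorm_conjTranspose, mul_comm]
        gcongr
        exact hb N _
    _ = C * κ * s ^ N * ‖X‖ * ‖Y‖ := by
        simp only [hκ, Finset.mul_sum, Finset.sum_mul]
        exact Finset.sum_congr rfl fun i _ => Finset.sum_congr rfl fun j _ => by ring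
    _ ≤ _ := by
        gcongr
        linarith

theorem exists_sum_norm_monomial_sq_le (h : TransferCondition p q v) (hp : IsStarProjection p)
    (hq : IsStarProjection q) :
    ∃ K : ℝ, 0 < K ∧ ∀ N : ℕ, ∑ u : Fin N → Fin n, ‖monomial v u‖ ^ 2 ≤ K := by
  obtain ⟨ρ, e, ρ', e', C, s, -, -, -, hC, hs0, hs1, hb⟩ := h.exists_asymptotics hp hq
  set E : Matrix (Fin k) (Fin k) ℂ := (ρ * 1).trace • e with hE
  refine ⟨k * (C * ‖(1 : Matrix (Fin k) (Fin k) ℂ)‖ + ‖E‖) + 1, ?_, fun N => ?_⟩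
  · exact add_pos_of_nonneg_of_pos (mul_nonneg (Nat.cast_nonneg _) (add_nonneg
      (mul_nonneg hC.le (norm_nonneg _)) (norm_nonneg _))) one_pos
  have h1 : ‖(transferMap v ^ N) 1‖ ≤ C * ‖(1 : Matrix (Fin k) (Fin k) ℂ)‖ + ‖E‖ := by
    have h2 : C * s ^ N * ‖(1 : Matrix (Fin k) (Fin k) ℂ)‖ ≤
        C * 1 * ‖(1 : Matrix (Fin k) (Fin k) ℂ)‖ := by
      gcongr
      exact pow_le_one₀ hs0.le hs1.le
    have h3 := hb N 1
    have h4 := norm_sub_norm_le ((transferMap v ^ N) 1) E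
    linarith
  have h5 := sum_norm_monomial_sq_le v N
  have h6 : (k : ℝ) * ‖(transferMap v ^ N) 1‖ ≤
      k * (C * ‖(1 : Matrix (Fin k) (Fin k) ℂ)‖ + ‖E‖) := by gcongr
  linarith

theorem exists_norm_gammaMap_le (h : TransferCondition p q v) (hp : IsStarProjection p)
    (hq : IsStarProjection q) :
    ∃ K : ℝ, 0 < K ∧ ∀ (N : ℕ) (X : Matrix (Fin k) (Fin k) ℂ), ‖gammaMap v N X‖ ≤ K * ‖X‖ := by
  obtain ⟨ρ, e, ρ', e', C, s, -, -, -, hC, hs0, hs1, hb⟩ := h.exists_gram hp hq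
  have hpos : 0 < k * ‖ρ‖ * ‖e‖ + C := add_pos_of_nonneg_of_pos
    (mul_nonneg (mul_nonneg (Nat.cast_nonneg _) (norm_nonneg _)) (norm_nonneg _)) hC
  refine ⟨√(k * ‖ρ‖ * ‖e‖ + C), Real.sqrt_pos.2 hpos, fun N X => ?_⟩
  have h1 := hb N X X
  have h2 := norm_trace_mul_le ρ e X X
  have h3 : C * s ^ N * ‖X‖ * ‖X‖ ≤ C * 1 * ‖X‖ * ‖X‖ := by
    gcongr
    exact pow_le_one₀ hs0.le hs1.le
  have h4 := norm_sub_norm_le (inner ℂ (gammaMap v N X) (gammaMap v N X)) (ρ * Xᴴ * e * X).trace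
  have h5 : ‖inner ℂ (gammaMap v N X) (gammaMap v N X)‖ = ‖gammaMap v N X‖ ^ 2 := by
    rw [inner_self_eq_norm_sq_to_K]
    simp
  rw [h5] at h4
  have h6 : ‖gammaMap v N X‖ ^ 2 ≤ (k * ‖ρ‖ * ‖e‖ + C) * ‖X‖ ^ 2 := by nlinarith
  calc ‖gammaMap v N X‖ = √(‖gammaMap v N X‖ ^ 2) := (Real.sqrt_sq (norm_nonneg _)).symm
    _ ≤ √((k * ‖ρ‖ * ‖e‖ + C) * ‖X‖ ^ 2) := Real.sqrt_le_sqrt h6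
    _ = _ := by rw [Real.sqrt_mul hpos.le, Real.sqrt_sq (norm_nonneg _)]

/-- For long chains, `Γ_{N,v}` is bounded below on `p M_k q`, uniformly in the length. -/
theorem exists_le_norm_gammaMap (h : TransferCondition p q v) (hp : IsStarProjection p)
    (hq : IsStarProjection q) :
    ∃ (K : ℝ) (M : ℕ), 0 < K ∧ ∀ N, M ≤ N → ∀ X : Matrix (Fin k) (Fin k) ℂ,
      p * X * q = X → ‖X‖ ≤ K * ‖gammaMap v N X‖ := by
  obtain ⟨K, hK, hΓ⟩ := h.exists_norm_gammaMap_le hp hq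
  obtain ⟨ρ, e, ρ', e', C, s, -, he', hρ', hC, hs0, hs1, hb⟩ := h.exists_gram hp hq
  set L : ℝ := ‖ρ'‖ * ‖e'‖ + 1 with hL
  have hL0 : 0 < L :=
    add_pos_of_nonneg_of_pos (mul_nonneg (norm_nonneg _) (norm_nonneg _)) one_pos
  have hlim : Tendsto (fun N : ℕ => L * (C * s ^ N)) atTop (𝓝 0) := by
    simpa using ((tendsto_pow_atTop_nhds_zero_of_lt_one hs0.le hs1).const_mul C).const_mul L
  obtain ⟨M, hM⟩ := (hlim.eventually_lt_const (show (0 : ℝ) < 1 / 2 by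
    norm_num)).exists_forall_of_atTop
  refine ⟨2 * L * K, M, mul_pos (mul_pos two_pos hL0) hK, fun N hN X hX => ?_⟩
  -- Test the Gram form against `W = (ρ Xᴴ e)ᴴ`.
  set V := ρ * Xᴴ * e with hV
  have hVW : ‖Vᴴ‖ = ‖V‖ := Matrix.l2_opNorm_conjTranspose V
  have hXV : ‖X‖ ≤ L * ‖V‖ := by
    have h1 : Xᴴ = ρ' * V * e' := by
      have h2 := congrArg Matrix.conjTranspose hX
      rw [Matrix.conjTranspose_mul, Matrix.conjTranspose_mul,
        show pᴴ = p from hp.isSelfAdjoint, show qᴴ = q from hq.isSelfAdjoint, ← he', ← hρ'] at h2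
      rw [← h2, hV]
      conv_rhs => rw [← h2]
      have h4 : ρ' * ρ * (ρ' * ρ) = ρ' * ρ := by rw [hρ', hq.isIdempotentElem.eq]
      have h5 : e * e' * (e * e') = e * e' := by rw [he', hp.isIdempotentElem.eq]
      calc ρ' * ρ * (Xᴴ * (e * e')) = ρ' * ρ * (ρ' * ρ) * (Xᴴ * (e * e' * (e * e'))) := by
            rw [h4, h5]
        _ = _ := by simp only [mul_assoc]
    calc ‖X‖ = ‖Xᴴ‖ := (Matrix.l2_opNorm_conjTranspose X).symm
      _ ≤ ‖ρ'‖ * ‖V‖ * ‖e'‖ := by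
        rw [h1]
        exact (norm_mul_le _ _).trans (by gcongr; exact norm_mul_le _ _)
      _ ≤ L * ‖V‖ := by
        calc ‖ρ'‖ * ‖V‖ * ‖e'‖ = ‖ρ'‖ * ‖e'‖ * ‖V‖ := by ring
          _ ≤ L * ‖V‖ := by
            gcongr
            linarith
  have hVle : ‖V‖ ≤ K * ‖gammaMap v N X‖ + C * s ^ N * ‖X‖ := by
    have h1 : ‖V‖ ^ 2 ≤ ‖(V * Vᴴ).trace‖ := (norm_sq_le_re_trace V).trans (Complex.re_le_norm _)
    have h2 := hb N X Vᴴ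
    have h3 : ‖inner ℂ (gammaMap v N X) (gammaMap v N Vᴴ)‖ ≤ ‖gammaMap v N X‖ * (K * ‖V‖) :=
      (norm_inner_le_norm _ _).trans (by
        gcongr
        rw [← hVW]
        exact hΓ N _)
    rw [norm_sub_rev, hVW] at h2
    have h4 := norm_sub_norm_le (V * Vᴴ).trace (inner ℂ (gammaMap v N X) (gammaMap v N Vᴴ))
    have h5 : ‖V‖ * ‖V‖ ≤ (K * ‖gammaMap v N X‖ + C * s ^ N * ‖X‖) * ‖V‖ := by
      calc ‖V‖ * ‖V‖ = ‖V‖ ^ 2 := (sq _).symm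
        _ ≤ ‖gammaMap v N X‖ * (K * ‖V‖) + C * s ^ N * ‖X‖ * ‖V‖ := by linarith
        _ = _ := by ring
    rcases (norm_nonneg V).eq_or_lt with h6 | h6
    · rw [← h6]
      exact add_nonneg (mul_nonneg hK.le (norm_nonneg _))
        (mul_nonneg (mul_nonneg hC.le (pow_nonneg hs0.le _)) (norm_nonneg _))
    · exact le_of_mul_le_mul_right h5 h6
  have h7 := (hM N hN).le
  have h8 : L * ‖V‖ ≤ L * K * ‖gammaMap v N X‖ + L * (C * s ^ N) * ‖X‖ :=
    (mul_le_mul_of_nonneg_left hVle hL0.le).trans (le_of_eq (by ring))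
  have h9 : L * (C * s ^ N) * ‖X‖ ≤ 1 / 2 * ‖X‖ := by gcongr
  linarith

theorem injectivityIndex_lt_top (h : TransferCondition p q v) (hp : IsStarProjection p)
    (hq : IsStarProjection q) : injectivityIndex v p q < ⊤ := by
  obtain ⟨K, M, hK, hM⟩ := h.exists_le_norm_gammaMap hp hq
  refine lt_of_le_of_lt (sInf_le ⟨M + 1, ⟨by omega, fun N hN => ?_⟩, rfl⟩) (ENat.natCast_lt_top _)
  rintro _ ⟨X, rfl⟩ _ ⟨Y, rfl⟩ hXY
  have hpp : p * p = p := hp.isIdempotentElem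
  have hqq : q * q = q := hq.isIdempotentElem
  have h1 := hM N (by omega) (p * X * q - p * Y * q) (by
    have : ∀ Z, p * (p * Z * q) * q = p * Z * q := by
      intro Z
      rw [mul_assoc, mul_assoc (p * Z), hqq, ← mul_assoc, ← mul_assoc, hpp]
    rw [mul_sub, sub_mul, this, this])
  rw [map_sub, sub_eq_zero.2 hXY, norm_zero, mul_zero] at h1
  exact sub_eq_zero.1 (norm_le_zero_iff.1 h1)

end TransferCondition

end Gram

/-! ### Dimension of the ground spaces -/

section Dimension

variable {n k : ℕ} {p q : Matrix (Fin k) (Fin k) ℂ} {v : Fin n → Matrix (Fin k) (Fin k) ℂ}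

/-- `Γ_{N,v}(X)` only depends on the numbers `Tr(X b^*)`, for `b` in a basis of `𝒦_N(v)`. -/
theorem finrank_groundSpace_le (v : Fin n → Matrix (Fin k) (Fin k) ℂ) (N : ℕ) :
    Module.finrank ℂ (groundSpace v N) ≤ Module.finrank ℂ (monomialSpan v N) := by
  set b := Module.finBasis ℂ (monomialSpan v N) with hb
  let m : (Fin N → Fin n) → monomialSpan v N := fun u =>
    ⟨monomial v u, monomial_mem_monomialSpan v u⟩
  let F : (Fin (Module.finrank ℂ (monomialSpan v N)) → ℂ) →ₗ[ℂ] ChainSpace n N :=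
    { toFun := fun t => WithLp.toLp 2 fun u => ∑ i, star (b.repr (m u) i) * t i
      map_add' := fun s t => by
        ext u
        simp [mul_add, Finset.sum_add_distrib]
      map_smul' := fun c t => by
        ext u
        simp only [PiLp.smul_apply, Pi.smul_apply, smul_eq_mul, RingHom.id_apply, Finset.mul_sum]
        exact Finset.sum_congr rfl fun i _ => by ring }
  have hle : groundSpace v N ≤ LinearMap.range F := by
    rintro _ ⟨X, rfl⟩
    refine ⟨fun i => (X * (b i : Matrix (Fin k) (Fin k) ℂ)ᴴ).trace, ?_⟩
    ext u
    have h1 : monomial v u = ∑ i, b.repr (m u) i • (b i : Matrix (Fin k) (Fin k) ℂ) := by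
      have := congrArg (Submodule.subtype _) (b.sum_repr (m u))
      rw [map_sum] at this
      exact this.symm
    rw [gammaMap_apply, h1, Matrix.conjTranspose_sum, Finset.mul_sum, Matrix.trace_sum]
    simp only [Matrix.conjTranspose_smul, Matrix.mul_smul, Matrix.trace_smul]
    rfl
  calc Module.finrank ℂ (groundSpace v N) ≤ Module.finrank ℂ (LinearMap.range F) :=
        Submodule.finrank_mono hle
    _ ≤ Module.finrank ℂ (Fin (Module.finrank ℂ (monomialSpan v N)) → ℂ) :=
        LinearMap.finrank_range_le F
    _ = _ := by simp

/-- The map `X ↦ p X q`. -/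
def cornerMap (p q : Matrix (Fin k) (Fin k) ℂ) : Module.End ℂ (Matrix (Fin k) (Fin k) ℂ) where
  toFun X := p * X * q
  map_add' X Y := by rw [mul_add, add_mul]
  map_smul' c X := by simp

theorem cornerMap_apply (p q X : Matrix (Fin k) (Fin k) ℂ) : cornerMap p q X = p * X * q := rfl

theorem rank_eq_trace {r : Matrix (Fin k) (Fin k) ℂ} (hr : IsIdempotentElem r) :
    (r.rank : ℂ) = r.trace := by
  have h1 : IsIdempotentElem (Matrix.toLin' r) := by
    rw [IsIdempotentElem, Module.End.mul_eq_comp, ← Matrix.toLin'_mul, hr.eq]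
  have h2 := (LinearMap.IsIdempotentElem.isProj_range _ h1).trace
  rw [Matrix.trace_toLin'_eq] at h2
  rw [h2]
  rfl

theorem finrank_range_cornerMap (hp : IsIdempotentElem p) (hq : IsIdempotentElem q) :
    Module.finrank ℂ (LinearMap.range (cornerMap p q)) = p.rank * q.rank := by
  have h1 : IsIdempotentElem (cornerMap p q) := by
    refine LinearMap.ext fun X => ?_
    rw [Module.End.mul_apply, cornerMap_apply, cornerMap_apply, mul_assoc, mul_assoc (p * X), hq.eq,
      ← mul_assoc, ← mul_assoc, hp.eq]
  have h2 := (LinearMap.IsIdempotentElem.isProj_range _ h1).trace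
  have h3 : LinearMap.trace ℂ _ (cornerMap p q) = p.trace * q.trace := by
    rw [LinearMap.trace_eq_matrix_trace ℂ (Matrix.stdBasis ℂ (Fin k) (Fin k)), Matrix.trace,
      Fintype.sum_prod_type, Matrix.trace, Matrix.trace, Finset.sum_mul_sum]
    refine Finset.sum_congr rfl fun i _ => Finset.sum_congr rfl fun j _ => ?_
    rw [Matrix.diag_apply, LinearMap.toMatrix_apply, Matrix.stdBasis_eq_single, cornerMap_apply]
    have : ∀ M : Matrix (Fin k) (Fin k) ℂ,
        (Matrix.stdBasis ℂ (Fin k) (Fin k)).repr M (i, j) = M i j := fun M => rfl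
    rw [this, Matrix.mul_apply, Finset.sum_eq_single j]
    · simp
    · intro l _ hl
      rw [Matrix.mul_single_apply_of_ne _ _ _ _ _ hl, zero_mul]
    · simp
  rw [h3, ← rank_eq_trace hp, ← rank_eq_trace hq] at h2
  exact_mod_cast h2.symm

/-- For long chains, every matrix product vector comes from exactly one matrix in `p M_k q`, with
control of norms. -/
theorem TransferCondition.exists_lift {m₁ : ℕ} (h : TransferCondition p q v)
    (hp : IsStarProjection p) (hq : IsStarProjection q) (h_rank : RankCondition p q v m₁) :
    ∃ (K : ℝ) (M : ℕ), 0 < K ∧ ∀ N, M ≤ N → ∀ f ∈ groundSpace v N,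
      ∃ X : Matrix (Fin k) (Fin k) ℂ, p * X * q = X ∧ gammaMap v N X = f ∧ ‖X‖ ≤ K * ‖f‖ := by
  obtain ⟨K, M, hK, hM⟩ := h.exists_le_norm_gammaMap hp hq
  refine ⟨K, max M m₁, hK, fun N hN f hf => ?_⟩
  have hfix : ∀ X ∈ LinearMap.range (cornerMap p q), p * X * q = X := by
    rintro _ ⟨X, rfl⟩
    rw [cornerMap_apply, mul_assoc, mul_assoc (p * X), hq.isIdempotentElem.eq, ← mul_assoc,
      ← mul_assoc, hp.isIdempotentElem.eq]
  have hMN := hM N (le_trans (le_max_left _ _) hN)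
  have hinj : Function.Injective
      ((gammaMap v N).domRestrict (LinearMap.range (cornerMap p q))) := by
    rw [injective_iff_map_eq_zero]
    intro X hX
    have h1 := hMN X (hfix X X.2)
    rw [LinearMap.domRestrict_apply] at hX
    rw [hX, norm_zero, mul_zero] at h1
    exact Subtype.ext (norm_le_zero_iff.1 h1)
  have hrange : LinearMap.range ((gammaMap v N).domRestrict (LinearMap.range (cornerMap p q))) =
      groundSpace v N := by
    refine Submodule.eq_of_le_of_finrank_le ?_ ?_
    · rintro _ ⟨X, rfl⟩
      exact ⟨X, rfl⟩
    · rw [LinearMap.finrank_range_of_inj hinj,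
        finrank_range_cornerMap hp.isIdempotentElem hq.isIdempotentElem,
        ← h_rank N (le_trans (le_max_right _ _) hN)]
      exact finrank_groundSpace_le v N
  rw [← hrange] at hf
  obtain ⟨X, rfl⟩ := hf
  exact ⟨X, hfix X X.2, rfl, hMN X (hfix X X.2)⟩

theorem TransferCondition.groundSpace_ne_bot (h : TransferCondition p q v)
    (hp : IsStarProjection p) (hq : IsStarProjection q) (l : ℕ) : groundSpace v l ≠ ⊥ := by
  intro h0
  obtain ⟨X, hX0, hX⟩ := h.exists_fixed hp hq
  have hmon : ∀ u : Fin l → Fin n, monomial v u = 0 := by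
    intro u
    have h1 : gammaMap v l (monomial v u) = 0 := by
      have : gammaMap v l (monomial v u) ∈ groundSpace v l := ⟨_, rfl⟩
      rwa [h0, Submodule.mem_bot] at this
    have h2 : (monomial v u * (monomial v u)ᴴ).trace = 0 := by
      rw [← gammaMap_apply, h1]
      rfl
    have h3 := norm_sq_le_re_trace (monomial v u)
    rw [h2, Complex.zero_re] at h3
    have h4 : ‖monomial v u‖ = 0 := by
      have : ‖monomial v u‖ ^ 2 = 0 := le_antisymm h3 (by positivity)
      exact (pow_eq_zero_iff two_ne_zero).1 this
    exact norm_eq_zero.1 h4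
  have h1 : (transferMap v ^ l) X = X := by
    clear h0 hmon
    induction l with
    | zero => simp
    | succ l ih => rw [pow_succ', Module.End.mul_apply, ih, hX]
  rw [transferMap_pow_apply] at h1
  simp only [hmon, zero_mul, Finset.sum_const_zero] at h1
  exact hX0 h1.symm

end Dimension

/-! ### The overlap estimate -/

section Overlap

variable {n k : ℕ} {p q : Matrix (Fin k) (Fin k) ℂ} {v : Fin n → Matrix (Fin k) (Fin k) ℂ}

/-- Overlap of `f(a w b) = Tr(X_b (v_a v_w)^*)` with `g(a w b) = Tr(Y_a (v_w v_b)^*)`, where `a`,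
`w`, `b` are words of lengths `r`, `j`, `1`: up to an error exponentially small in `j` it equals
`Tr(Z U)` with `Z = ∑ X_b ρ v_b` and `U = ∑ Y_a^* e v_a^*`, and orthogonality of `f` to the ground
space of all `r + j + 1` sites makes `Z` exponentially small. -/
theorem norm_inner_le_of_gram {ρ e e' : Matrix (Fin k) (Fin k) ℂ} {C s : ℝ} (he' : e' * e = p)
    (hC : 0 < C) (hs0 : 0 < s) (hs1 : s < 1)
    (hb : ∀ (N : ℕ) (X Y : Matrix (Fin k) (Fin k) ℂ),
        ‖inner ℂ (gammaMap v N X) (gammaMap v N Y) - (ρ * Xᴴ * e * Y).trace‖ ≤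
          C * s ^ N * ‖X‖ * ‖Y‖)
    {r j : ℕ} {f g : ChainSpace n (r + j + 1)}
    {X : Fin n → Matrix (Fin k) (Fin k) ℂ} {Y : (Fin r → Fin n) → Matrix (Fin k) (Fin k) ℂ}
    (hX : ∀ b (u : Fin (r + j) → Fin n),
      f (Fin.snoc u b : Fin (r + j + 1) → Fin n) = gammaMap v (r + j) (X b) u)
    (hpX : ∀ b, p * X b = X b)
    (hY : ∀ a (w : Fin (j + 1) → Fin n),
      g (Fin.append (m := r) (n := j + 1) a w) = gammaMap v (j + 1) (Y a) w)
    (horth : ∀ W ∈ groundSpace v (r + j + 1), inner ℂ W f = 0) :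
    ‖inner ℂ g f‖ ≤ C * (1 + k * ‖e'‖ * ‖e‖) * s ^ j *
      ((∑ a, ‖Y a‖ * ‖monomial v a‖) * ∑ b, ‖v b‖ * ‖X b‖) := by
  set A := ∑ a, ‖Y a‖ * ‖monomial v a‖ with hA
  set S := ∑ b, ‖v b‖ * ‖X b‖ with hS
  have hA0 : 0 ≤ A := Finset.sum_nonneg fun a _ => mul_nonneg (norm_nonneg _) (norm_nonneg _)
  have hS0 : 0 ≤ S := Finset.sum_nonneg fun b _ => mul_nonneg (norm_nonneg _) (norm_nonneg _)
  obtain ⟨Z, hZ⟩ : ∃ Z, Z = ∑ b, X b * ρ * v b := ⟨_, rfl⟩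
  obtain ⟨U, hU⟩ : ∃ U, U = ∑ a, (Y a)ᴴ * e * (monomial v a)ᴴ := ⟨_, rfl⟩
  have hZU : (Z * U).trace =
      ∑ b, ∑ a, (ρ * (Y a * (v b)ᴴ)ᴴ * e * ((monomial v a)ᴴ * X b)).trace := by
    rw [hZ, hU, Finset.sum_mul_sum, Matrix.trace_sum]
    refine Finset.sum_congr rfl fun b _ => ?_
    rw [Matrix.trace_sum]
    refine Finset.sum_congr rfl fun a _ => ?_
    rw [Matrix.conjTranspose_mul, Matrix.conjTranspose_conjTranspose, mul_assoc (X b),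
      mul_assoc (X b), Matrix.trace_mul_comm]
    simp only [mul_assoc]
  have hinner : inner ℂ g f = ∑ b, ∑ a,
      inner ℂ (gammaMap v j (Y a * (v b)ᴴ)) (gammaMap v j ((monomial v a)ᴴ * X b)) := by
    simp only [PiLp.inner_apply]
    rw [sum_snoc]
    refine Finset.sum_congr rfl fun b _ => ?_
    rw [sum_append]
    refine Finset.sum_congr rfl fun a _ => Finset.sum_congr rfl fun w _ => ?_
    have hf : f (Fin.snoc (Fin.append a w) b : Fin (r + j + 1) → Fin n) =
        gammaMap v j ((monomial v a)ᴴ * X b) w := by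
      rw [hX, gammaMap_apply, gammaMap_apply, monomial_append, Matrix.conjTranspose_mul,
        ← mul_assoc, Matrix.trace_mul_comm, ← mul_assoc]
    have hg : g (Fin.snoc (Fin.append a w) b : Fin (r + j + 1) → Fin n) =
        gammaMap v j (Y a * (v b)ᴴ) w := by
      have h1 : (Fin.snoc (Fin.append a w) b : Fin (r + j + 1) → Fin n) =
          Fin.append (m := r) (n := j + 1) a (Fin.snoc w b : Fin (j + 1) → Fin n) :=
        (Fin.append_snoc a w b).symm
      rw [h1, hY, gammaMap_apply, gammaMap_apply, monomial_snoc, Matrix.conjTranspose_mul,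
        mul_assoc]
    rw [hf, hg]
  have herr : ‖inner ℂ g f - (Z * U).trace‖ ≤ C * s ^ j * (A * S) := by
    rw [hinner, hZU, ← Finset.sum_sub_distrib]
    simp only [← Finset.sum_sub_distrib]
    calc _ ≤ ∑ b, ∑ a, C * s ^ j * ((‖Y a‖ * ‖monomial v a‖) * (‖v b‖ * ‖X b‖)) := by
          refine (norm_sum_le _ _).trans (Finset.sum_le_sum fun b _ => ?_)
          refine (norm_sum_le _ _).trans (Finset.sum_le_sum fun a _ => ?_)
          refine (hb j _ _).trans ?_
          have h1 : ‖Y a * (v b)ᴴ‖ ≤ ‖Y a‖ * ‖v b‖ := by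
            rw [← Matrix.l2_opNorm_conjTranspose (v b)]
            exact norm_mul_le _ _
          have h2 : ‖(monomial v a)ᴴ * X b‖ ≤ ‖monomial v a‖ * ‖X b‖ := by
            rw [← Matrix.l2_opNorm_conjTranspose (monomial v a)]
            exact norm_mul_le _ _
          calc C * s ^ j * ‖Y a * (v b)ᴴ‖ * ‖(monomial v a)ᴴ * X b‖
              ≤ C * s ^ j * (‖Y a‖ * ‖v b‖) * (‖monomial v a‖ * ‖X b‖) := by gcongr
            _ = _ := by ring
      _ = C * s ^ j * (A * S) := by
        rw [hA, hS, Finset.sum_mul_sum, Finset.sum_comm]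
        simp only [Finset.mul_sum]
  -- Orthogonality to `Γ(e Z)` bounds `e Z`, hence `Z`.
  have heZ : ‖e * Z‖ ≤ C * s ^ (r + j) * S := by
    have h1 : ∀ W : Matrix (Fin k) (Fin k) ℂ, (e * Z * Wᴴ).trace =
        ∑ b, (ρ * (W * (v b)ᴴ)ᴴ * e * X b).trace := by
      intro W
      rw [hZ, Finset.mul_sum, Finset.sum_mul, Matrix.trace_sum]
      refine Finset.sum_congr rfl fun b _ => ?_
      rw [Matrix.conjTranspose_mul, Matrix.conjTranspose_conjTranspose, ← mul_assoc,
        ← mul_assoc, mul_assoc (e * X b) ρ, mul_assoc (e * X b), Matrix.trace_mul_comm]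
      simp only [mul_assoc]
    have h2 : ∑ b, inner ℂ (gammaMap v (r + j) (e * Z * (v b)ᴴ))
        (gammaMap v (r + j) (X b)) = 0 := by
      rw [← horth (gammaMap v (r + j + 1) (e * Z)) ⟨_, rfl⟩]
      simp only [PiLp.inner_apply]
      rw [sum_snoc]
      refine Finset.sum_congr rfl fun b _ => Finset.sum_congr rfl fun u _ => ?_
      rw [hX, gammaMap_apply, gammaMap_apply _ (e * Z), monomial_snoc, Matrix.conjTranspose_mul,
        mul_assoc]
    have h3 : ‖(e * Z * (e * Z)ᴴ).trace‖ ≤ C * s ^ (r + j) * S * ‖e * Z‖ := by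
      have h4 : (e * Z * (e * Z)ᴴ).trace = -∑ b,
          (inner ℂ (gammaMap v (r + j) (e * Z * (v b)ᴴ)) (gammaMap v (r + j) (X b)) -
            (ρ * (e * Z * (v b)ᴴ)ᴴ * e * X b).trace) := by
        rw [Finset.sum_sub_distrib, h2, ← h1, zero_sub, neg_neg]
      rw [h4, norm_neg, hS, Finset.mul_sum, Finset.sum_mul]
      refine (norm_sum_le _ _).trans (Finset.sum_le_sum fun b _ => ?_)
      refine (hb (r + j) _ _).trans ?_
      have h5 : ‖e * Z * (v b)ᴴ‖ ≤ ‖e * Z‖ * ‖v b‖ := by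
        rw [← Matrix.l2_opNorm_conjTranspose (v b)]
        exact norm_mul_le _ _
      calc C * s ^ (r + j) * ‖e * Z * (v b)ᴴ‖ * ‖X b‖
          ≤ C * s ^ (r + j) * (‖e * Z‖ * ‖v b‖) * ‖X b‖ := by gcongr
        _ = _ := by ring
    have h6 := (norm_sq_le_re_trace (e * Z)).trans ((Complex.re_le_norm _).trans h3)
    rcases (norm_nonneg (e * Z)).eq_or_lt with h7 | h7
    · rw [← h7]
      exact mul_nonneg (mul_nonneg hC.le (pow_nonneg hs0.le _)) hS0
    · rw [sq] at h6
      exact le_of_mul_le_mul_right h6 h7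
  have hZ' : ‖Z‖ ≤ ‖e'‖ * (C * s ^ j * S) := by
    have h1 : Z = e' * (e * Z) := by
      rw [← mul_assoc, he', hZ, Finset.mul_sum]
      refine Finset.sum_congr rfl fun b _ => ?_
      rw [← mul_assoc, ← mul_assoc, hpX]
    have h2 : C * s ^ (r + j) * S ≤ C * s ^ j * S := by
      refine mul_le_mul_of_nonneg_right (mul_le_mul_of_nonneg_left ?_ hC.le) hS0
      exact pow_le_pow_of_le_one hs0.le hs1.le (Nat.le_add_left _ _)
    calc ‖Z‖ = ‖e' * (e * Z)‖ := by rw [← h1]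
      _ ≤ ‖e'‖ * ‖e * Z‖ := norm_mul_le _ _
      _ ≤ _ := mul_le_mul_of_nonneg_left (heZ.trans h2) (norm_nonneg _)
  have hU' : ‖U‖ ≤ ‖e‖ * A := by
    rw [hU, hA, Finset.mul_sum]
    refine (norm_sum_le _ _).trans (Finset.sum_le_sum fun a _ => ?_)
    calc ‖(Y a)ᴴ * e * (monomial v a)ᴴ‖ ≤ ‖(Y a)ᴴ‖ * ‖e‖ * ‖(monomial v a)ᴴ‖ :=
          (norm_mul_le _ _).trans (mul_le_mul_of_nonneg_right (norm_mul_le _ _) (norm_nonneg _))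
      _ = _ := by
        rw [Matrix.l2_opNorm_conjTranspose, Matrix.l2_opNorm_conjTranspose]
        ring
  have hmain : ‖(Z * U).trace‖ ≤ k * (‖e'‖ * (C * s ^ j * S) * (‖e‖ * A)) := by
    refine (norm_trace_le _).trans (mul_le_mul_of_nonneg_left ?_ (Nat.cast_nonneg _))
    exact (norm_mul_le _ _).trans (mul_le_mul hZ' hU' (norm_nonneg _)
      ((norm_nonneg _).trans hZ'))
  have h1 := norm_sub_norm_le (inner ℂ g f) (Z * U).trace
  calc ‖inner ℂ g f‖ ≤ C * s ^ j * (A * S) + k * (‖e'‖ * (C * s ^ j * S) * (‖e‖ * A)) := by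
        linarith
    _ = _ := by ring

theorem norm_sq_eq_sum_snoc {N : ℕ} (f : ChainSpace n (N + 1)) :
    ‖f‖ ^ 2 = ∑ b, ‖(WithLp.toLp 2 fun u => f (Fin.snoc u b : Fin (N + 1) → Fin n) :
      ChainSpace n N)‖ ^ 2 := by
  simp only [EuclideanSpace.norm_sq_eq]
  exact sum_snoc _

theorem norm_sq_eq_sum_append {r l : ℕ} (f : ChainSpace n (r + l)) :
    ‖f‖ ^ 2 = ∑ a, ‖(WithLp.toLp 2 fun w => f (Fin.append a w) : ChainSpace n l)‖ ^ 2 := by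
  simp only [EuclideanSpace.norm_sq_eq]
  exact sum_append _

theorem sum_mul_le_of_sq {ι : Type*} [Fintype ι] {x y : ι → ℝ} {a b : ℝ} (ha : 0 ≤ a) (hb : 0 ≤ b)
    (hx : ∑ i, x i ^ 2 ≤ a ^ 2) (hy : ∑ i, y i ^ 2 ≤ b ^ 2) : ∑ i, x i * y i ≤ a * b := by
  refine le_of_sq_le_sq ?_ (mul_nonneg ha hb)
  calc (∑ i, x i * y i) ^ 2 ≤ (∑ i, x i ^ 2) * ∑ i, y i ^ 2 := Finset.sum_mul_sq_le_sq_mul_sq _ _ _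
    _ ≤ a ^ 2 * b ^ 2 := mul_le_mul hx hy (Finset.sum_nonneg fun i _ => sq_nonneg _) (sq_nonneg _)
    _ = _ := by ring

theorem TransferCondition.exists_norm_inner_le {m₁ : ℕ} (h : TransferCondition p q v)
    (hp : IsStarProjection p) (hq : IsStarProjection q) (h_rank : RankCondition p q v m₁) :
    ∃ (C s : ℝ) (M : ℕ), 0 < C ∧ 0 < s ∧ s < 1 ∧ ∀ r j, M ≤ j →
      ∀ f g : ChainSpace n (r + j + 1),
        f ∈ ampliateSubspace 0 (r + j) (r + j + 1) (by omega) (groundSpace v (r + j)) →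
        (∀ W ∈ groundSpace v (r + j + 1), inner ℂ W f = 0) →
        g ∈ ampliateSubspace r (j + 1) (r + (j + 1)) le_rfl (groundSpace v (j + 1)) →
        ‖inner ℂ g f‖ ≤ C * s ^ j * (‖g‖ * ‖f‖) := by
  obtain ⟨K, M, hK, hlift⟩ := h.exists_lift hp hq h_rank
  obtain ⟨L, hL, hmon⟩ := h.exists_sum_norm_monomial_sq_le hp hq
  obtain ⟨ρ, e, ρ', e', C, s, he', -, -, hC, hs0, hs1, hb⟩ := h.exists_gram hp hq
  have hpp : p * p = p := hp.isIdempotentElem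
  obtain ⟨D, hD⟩ : ∃ D : ℝ, D = C * (1 + k * ‖e'‖ * ‖e‖) := ⟨_, rfl⟩
  have hD0 : 0 < D := by
    rw [hD]
    exact mul_pos hC (add_pos_of_pos_of_nonneg one_pos
      (mul_nonneg (mul_nonneg (Nat.cast_nonneg _) (norm_nonneg _)) (norm_nonneg _)))
  refine ⟨D * (K * √L * (√L * K)), s, M, by positivity, hs0, hs1, fun r j hj f g hf horth hg => ?_⟩
  rw [mem_ampliateSubspace_snoc] at hf
  rw [mem_ampliateSubspace_append] at hg
  choose X hX₁ hX₂ hX₃ using fun b => hlift (r + j) (by omega) _ (hf b)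
  choose Y hY₁ hY₂ hY₃ using fun a => hlift (j + 1) (by omega) _ (hg a)
  have h1 := norm_inner_le_of_gram (v := v) (f := f) (g := g) he' hC hs0 hs1 hb
    (fun b u => (congrArg (fun F : ChainSpace n (r + j) => F u) (hX₂ b)).symm)
    (fun b => by rw [← hX₁ b, ← mul_assoc, ← mul_assoc, hpp])
    (fun a w => (congrArg (fun F : ChainSpace n (j + 1) => F w) (hY₂ a)).symm) horth
  have hXsum : ∑ b, ‖X b‖ ^ 2 ≤ (K * ‖f‖) ^ 2 := by
    rw [mul_pow, norm_sq_eq_sum_snoc f, Finset.mul_sum]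
    refine Finset.sum_le_sum fun b _ => ?_
    rw [← mul_pow]
    exact pow_le_pow_left₀ (norm_nonneg _) (hX₃ b) 2
  have hYsum : ∑ a, ‖Y a‖ ^ 2 ≤ (K * ‖g‖) ^ 2 := by
    rw [mul_pow, norm_sq_eq_sum_append (r := r) (l := j + 1) g, Finset.mul_sum]
    refine Finset.sum_le_sum fun a _ => ?_
    rw [← mul_pow]
    exact pow_le_pow_left₀ (norm_nonneg _) (hY₃ a) 2
  have hmon' : ∀ N : ℕ, ∑ u : Fin N → Fin n, ‖monomial v u‖ ^ 2 ≤ √L ^ 2 := by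
    intro N
    rw [Real.sq_sqrt hL.le]
    exact hmon N
  have hvsum : ∑ b, ‖v b‖ ^ 2 ≤ √L ^ 2 := by
    have h2 := hmon' 1
    rw [sum_cons] at h2
    simpa [monomial_cons] using h2
  have hA := sum_mul_le_of_sq (by positivity) (by positivity) hYsum (hmon' r)
  have hS := sum_mul_le_of_sq (by positivity) (by positivity) hvsum hXsum
  rw [← hD] at h1
  calc ‖inner ℂ g f‖ ≤ D * s ^ j * ((K * ‖g‖ * √L) * (√L * (K * ‖f‖))) := by
        refine h1.trans (mul_le_mul_of_nonneg_left ?_ (by positivity))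
        refine mul_le_mul hA hS ?_ (by positivity)
        exact Finset.sum_nonneg fun b _ => mul_nonneg (norm_nonneg _) (norm_nonneg _)
    _ = _ := by ring

/-- An operator `P_A (P_B - P_E)` with `E ≤ B` is controlled by inner products of vectors in `A`
with vectors in `B` orthogonal to `E`. -/
theorem norm_projection_comp_sub_le {l : ℕ} {A B E : Submodule ℂ (ChainSpace n l)} (hEB : E ≤ B)
    {δ : ℝ} (hδ : 0 ≤ δ)
    (hbound : ∀ f g : ChainSpace n l, f ∈ B → (∀ W ∈ E, inner ℂ W f = 0) → g ∈ A →
      ‖inner ℂ g f‖ ≤ δ * (‖g‖ * ‖f‖)) :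
    ‖projection A ∘L (projection B - projection E)‖ ≤ 2 * δ := by
  refine ContinuousLinearMap.opNorm_le_bound _ (by positivity) fun ψ => ?_
  rw [ContinuousLinearMap.comp_apply, sub_apply]
  set f := projection B ψ - projection E ψ with hf
  have hfB : f ∈ B := B.sub_mem (projection_apply_mem B ψ) (hEB (projection_apply_mem E ψ))
  have hfE : ∀ W ∈ E, inner ℂ W f = 0 := by
    intro W hW
    rw [hf, inner_sub_right, inner_projection B (hEB hW), inner_projection E hW, sub_self]
  have hfψ : ‖f‖ ≤ 2 * ‖ψ‖ := by
    have h1 := norm_sub_le (projection B ψ) (projection E ψ)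
    have h2 := norm_projection_apply_le B ψ
    have h3 := norm_projection_apply_le E ψ
    linarith
  have hgA := projection_apply_mem A f
  have h1 := hbound f _ hfB hfE hgA
  rw [← inner_projection A hgA f, inner_self_eq_norm_sq_to_K] at h1
  have h2 : ‖projection A f‖ * ‖projection A f‖ ≤ δ * ‖f‖ * ‖projection A f‖ := by
    have h3 : ‖((‖projection A f‖ : ℂ)) ^ 2‖ = ‖projection A f‖ * ‖projection A f‖ := by
      simp [sq]
    calc _ = ‖((‖projection A f‖ : ℂ)) ^ 2‖ := h3.symm
      _ ≤ _ := h1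
      _ = _ := by ring
  have h4 : ‖projection A f‖ ≤ δ * ‖f‖ := by
    rcases (norm_nonneg (projection A f)).eq_or_lt with h5 | h5
    · rw [← h5]
      positivity
    · exact le_of_mul_le_mul_right h2 h5
  calc ‖projection A f‖ ≤ δ * ‖f‖ := h4
    _ ≤ δ * (2 * ‖ψ‖) := by gcongr
    _ = _ := by ring

theorem exists_overlap_lt {m₁ : ℕ} (h : TransferCondition p q v)
    (hp : IsStarProjection p) (hq : IsStarProjection q) (h_rank : RankCondition p q v m₁) :
    ∃ l₀ : ℕ, 1 ≤ l₀ ∧ ∀ l, l₀ ≤ l → ∃ ε : ℝ, 0 < ε ∧ ε < 1 / √(l : ℝ) ∧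
      ∀ (N : ℕ) (hN : 2 * l ≤ N),
        ‖ampliate (N - l + 1) l (N + 1) (by omega) (projection (groundSpace v l)) ∘L
          (ampliate 0 N (N + 1) (by omega) (projection (groundSpace v N)) -
            projection (groundSpace v (N + 1)))‖ < ε := by
  obtain ⟨C, s, M, hC, hs0, hs1, hb⟩ := h.exists_norm_inner_le hp hq h_rank
  have hlim : Tendsto (fun j : ℕ => (2 * C + 1) * s⁻¹ * ((j : ℝ) * s ^ j)) atTop (𝓝 0) := by
    simpa using (tendsto_self_mul_const_pow_of_lt_one hs0.le hs1).const_mul ((2 * C + 1) * s⁻¹)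
  obtain ⟨J, hJ⟩ := (hlim.eventually_lt_const one_pos).exists_forall_of_atTop
  refine ⟨max J (M + 1), le_trans (by omega) (le_max_right _ _), fun l hl => ?_⟩
  have hlJ : J ≤ l := le_trans (le_max_left _ _) hl
  have hlM : M + 1 ≤ l := le_trans (le_max_right _ _) hl
  obtain ⟨j, rfl⟩ : ∃ j, l = j + 1 := ⟨l - 1, by omega⟩
  refine ⟨(2 * C + 1) * s ^ j, by positivity, ?_, fun N hN => ?_⟩
  · have h1 := hJ (j + 1) hlJ
    have h2 : (2 * C + 1) * s⁻¹ * (((j + 1 : ℕ) : ℝ) * s ^ (j + 1)) =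
        (2 * C + 1) * s ^ j * ((j + 1 : ℕ) : ℝ) := by
      field_simp
      exact pow_succ' s j
    rw [h2] at h1
    have h3 : (1 : ℝ) ≤ ((j + 1 : ℕ) : ℝ) := by exact_mod_cast Nat.le_add_left 1 j
    have h4 : √((j + 1 : ℕ) : ℝ) ≤ ((j + 1 : ℕ) : ℝ) := by
      rw [Real.sqrt_le_left (by linarith)]
      nlinarith
    rw [lt_div_iff₀ (Real.sqrt_pos.2 (by linarith))]
    exact lt_of_le_of_lt (mul_le_mul_of_nonneg_left h4 (by positivity)) h1
  · obtain ⟨r, rfl⟩ : ∃ r, N = r + j := ⟨N - j, by omega⟩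
    have hlt : 2 * (C * s ^ j) < (2 * C + 1) * s ^ j := by
      have := pow_pos hs0 j
      nlinarith
    refine lt_of_le_of_lt ?_ hlt
    have key : ∀ (x : ℕ) (hx : x + (j + 1) ≤ r + j + 1), x = r →
        ‖ampliate x (j + 1) (r + j + 1) hx (projection (groundSpace v (j + 1))) ∘L
          (ampliate 0 (r + j) (r + j + 1) (by omega) (projection (groundSpace v (r + j))) -
            projection (groundSpace v (r + j + 1)))‖ ≤ 2 * (C * s ^ j) := by
      rintro x hx rfl
      rw [ampliate_projection, ampliate_projection]
      exact norm_projection_comp_sub_le (groundSpace_le_ampliateSubspace v _ _ _ _)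
        (by positivity) fun f g hf hfE hg => hb x j (by omega) f g hf hfE hg
    exact key _ _ (by omega)

end Overlap

end MPS

theorem proposition2p6 (n k m₁ m₂ m₃ : ℕ) (hn : 1 ≤ n) (hk : 1 ≤ k)
    (hm₁ : 1 ≤ m₁) (hm₂ : 1 ≤ m₂) (hm₃ : 1 ≤ m₃)
    (p q : Matrix (Fin k) (Fin k) ℂ) (hp : IsStarProjection p) (hq : IsStarProjection q)
    (v : Fin n → Matrix (Fin k) (Fin k) ℂ)
    (h_transfer : MPS.TransferCondition p q v)
    (h_rank : MPS.RankCondition p q v m₁)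
    (h_shift : MPS.ShiftCondition v m₂ m₃) :
    MPS.injectivityIndex v p q < ⊤ ∧
      ∃ l₀ : ℕ, MPS.GapCondition (MPS.groundSpace v) (m₂ + m₃) l₀ := by
  obtain ⟨l₀, hl₀, hoverlap⟩ := MPS.exists_overlap_lt h_transfer hp hq h_rank
  exact ⟨h_transfer.injectivityIndex_lt_top hp hq, l₀,
    { ne_bot := fun l _ => h_transfer.groundSpace_ne_bot hp hq l
      one_le_m := by omega
      one_le_l := hl₀
      intersection := MPS.intersectionProperty_groundSpace hn hm₂ h_shift
      overlap := hoverlap }⟩
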